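/- Let $k$ be a field of characteristic $0$, let $Q_A$ be a finite quiver, and let $A=kQ_A/I_A$ be a finite dimensional monomial algebra, where $I_A$ is the two-sided ideal generated by a set of paths of length $\ge 2$. Paths are composed from right to left, and $s(\cdot)$, $t(\cdot)$ denote starting and ending vertices. Let $\alpha:e_1\to e_2$ be a source arrow of $Q_A$ (no arrow ends at $e_1$, and no arrow other than $\alpha$ starts at $e_1$ or ends at $e_2$) and let $\beta:e_{n-1}\to e_n$ be a sink arrow (no arrow starts at $e_n$, and no arrow other than $\beta$ starts at $e_{n-1}$ or ends at $e_n$). Assume that $e_1,e_2,e_{n-1},e_n$ are pairwise different and that $\alpha,\beta$ lie in the same block of $A$, that is, in the same connected component of $Q_A$. Let $B$ be the algebra obtained from $A$ by gluing $\alpha$ and $\beta$: the subalgebra of $A$ generated by $f_1=e_1+e_{n-1}$, $f_2=e_2+e_n$, the remaining vertices $f_i=e_i$, the element $\gamma^*=\alpha+\beta$, and all arrows other than $\alpha,\beta$. For a path $p$ of $Q_A$ let $p^*\in B$ be its image under $e_1,e_{n-1}\mapsto f_1$, $e_2,e_n\mapsto f_2$, $\alpha,\beta\mapsto\gamma^*$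 (all other vertices and arrows being fixed). For an algebra $C$, let $\mathrm{HH}^1(C)$ be the Lie algebra of $k$-linear derivations of $C$ modulo inner derivations, with the commutator bracket. For an arrow $b$ and a path $q\notin I$ parallel to it, $b\|q$ denotes the cochain with value $q$ at $b$ and $0$ at the other arrows. Linear combinations of these are the $1$-cochains; a cocycle is identified with the derivation that kills all vertices and has the values of the cochain on the arrows. For $p\notin I$ a cycle (possibly trivial) at a vertex $e$, put $$\delta^0(e\|p)=\sum_{s(a)=e,\ ap\notin I}a\|ap-\sum_{t(a)=e,\ pa\notin I}a\|pa ,$$ where $a$ runs over arrows. Let $\psi_1$ be the linear map with $\psi_1(a\|p)=a^*\|p^*$. Let $Z_{sp}(\alpha,\beta)$ be the span of all $\delta_B^0(f_1\|p^*)$ and $\delta_B^0(f_2\|q^*)$, where $p$ (resp. $q$) runs over the paths not in $I_A$, of length $\ge 1$, between $e_1$ and $e_{n-1}$ (resp. $e_2$ and $e_n$), in either direction, for which this element is non-zero. Put $Y=\psi_1(\mathrm{Im}\,\delta_A^0)+Z_{sp}(\alpha,\beta)$, and let $I=Y/\mathrm{Im}\,\delta^0_B$ be its image in $\mathrm{HH}^1(B)$.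 Then $I$ is the line spanned by the class of $\gamma^*\|\gamma^*$, that is, of the derivation of $B$ that fixes $\gamma^*$ and kills all the $f_i$ and all other arrows. This one-dimensional space $I$ is a Lie ideal of $\mathrm{HH}^1(B)$ contained in the center of $\mathrm{HH}^1(B)$, and there is an isomorphism of Lie algebras $$\mathrm{HH}^1(B)\simeq \mathrm{HH}^1(A)\times k .$$ -/

import Mathlib

attribute [local instance 100] LieRing.ofAssociativeRing

noncomputable section

namespace ArrowGluing

/-! ## Path algebras and monomial algebras -/

section PathAlgebra

/-- A path in the quiver `V`, together with its starting and ending vertex. -/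
@[ext]
structure QPath (V : Type*) [Quiver V] where
  src : V
  tgt : V
  path : Quiver.Path src tgt

/-- The trivial path at a vertex. -/
def QPath.triv {V : Type*} [Quiver V] (v : V) : QPath V := ⟨v, v, Quiver.Path.nil⟩

/-- An arrow, as a path of length one. -/
def QPath.arrow {V : Type*} [Quiver V] (a : Quiver.Total V) : QPath V :=
  ⟨a.left, a.right, a.hom.toPath⟩

/-- The underlying vector space of the path algebra `kQ`: its basis is the set of all paths. -/
def PathAlgebra (k : Type*) [Field k] (V : Type*) [Quiver V] : Type _ := QPath V →₀ k

variable (k : Type*) [Field k] {V : Type*} [Quiver V]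

instance : AddCommGroup (PathAlgebra k V) := inferInstanceAs (AddCommGroup (QPath V →₀ k))

instance : Module k (PathAlgebra k V) := inferInstanceAs (Module k (QPath V →₀ k))

/-- The basis of the path algebra given by the paths. -/
def PathAlgebra.basis : Module.Basis (QPath V) k (PathAlgebra k V) :=
  Module.Basis.ofRepr (LinearEquiv.refl k (QPath V →₀ k))

/-- The basis element of `kQ` given by a path. -/
def PathAlgebra.of (p : QPath V) : PathAlgebra k V := PathAlgebra.basis k p

/-- The product `pq` of two paths: first `q`, then `p`; it is zero if `q` does not end where `p`
starts. -/
def pathMul (p q : QPath V) : PathAlgebra k V :=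
  open Classical in
  if h : q.tgt = p.src then
    PathAlgebra.of k ⟨q.src, p.tgt, q.path.comp (p.path.cast h.symm rfl)⟩
  else 0

/-- The bilinear extension of the product of paths. -/
def PathAlgebra.mulHom : PathAlgebra k V →ₗ[k] PathAlgebra k V →ₗ[k] PathAlgebra k V :=
  (PathAlgebra.basis k).constr k fun p => (PathAlgebra.basis k).constr k fun q => pathMul k p q

instance : Mul (PathAlgebra k V) := ⟨fun x y => PathAlgebra.mulHom k x y⟩

instance [Fintype V] : One (PathAlgebra k V) := ⟨∑ v : V, PathAlgebra.of k (QPath.triv v)⟩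

theorem PathAlgebra.mul_def (x y : PathAlgebra k V) : x * y = PathAlgebra.mulHom k x y := rfl

theorem PathAlgebra.one_def [Fintype V] :
    (1 : PathAlgebra k V) = ∑ v : V, PathAlgebra.of k (QPath.triv v) := rfl

theorem PathAlgebra.mulHom_of_of (p q : QPath V) :
    PathAlgebra.mulHom k (PathAlgebra.of k p) (PathAlgebra.of k q) = pathMul k p q := by
  simp [PathAlgebra.mulHom, PathAlgebra.of, Module.Basis.constr_basis]

theorem PathAlgebra.of_mul_of (p q : QPath V) :
    PathAlgebra.of k p * PathAlgebra.of k q = pathMul k p q :=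
  PathAlgebra.mulHom_of_of k p q

theorem PathAlgebra.induction_on {P : PathAlgebra k V → Prop} (x : PathAlgebra k V)
    (hz : P 0) (hadd : ∀ x y, P x → P y → P (x + y)) (hsmul : ∀ (c : k) x, P x → P (c • x))
    (hof : ∀ p : QPath V, P (PathAlgebra.of k p)) : P x := by
  have hx : x ∈ Submodule.span k (Set.range (PathAlgebra.basis k (V := V))) := by
    rw [(PathAlgebra.basis k).span_eq]
    trivial
  induction hx using Submodule.span_induction with
  | mem x h =>
    obtain ⟨p, rfl⟩ := h
    exact hof p
  | zero => exact hz
  | add x y _ _ hx hy => exact hadd x y hx hy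
  | smul c x _ hx => exact hsmul c x hx

theorem pathMul_of_eq {u v w : V} (q : Quiver.Path u v) (p : Quiver.Path v w) :
    pathMul k ⟨v, w, p⟩ ⟨u, v, q⟩ = PathAlgebra.of k ⟨u, w, q.comp p⟩ := by
  simp [pathMul]

theorem pathMul_of_ne {p q : QPath V} (h : q.tgt ≠ p.src) : pathMul k p q = 0 := by
  simp [pathMul, h]

theorem PathAlgebra.of_mul_assoc (p q r : QPath V) :
    PathAlgebra.of k p * PathAlgebra.of k q * PathAlgebra.of k r =
      PathAlgebra.of k p * (PathAlgebra.of k q * PathAlgebra.of k r) := by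
  have hz : ∀ x : PathAlgebra k V, 0 * x = 0 := fun x => by simp [PathAlgebra.mul_def]
  have hz' : ∀ x : PathAlgebra k V, x * 0 = 0 := fun x => by simp [PathAlgebra.mul_def]
  obtain ⟨p1, p2, p⟩ := p
  obtain ⟨q1, q2, q⟩ := q
  obtain ⟨r1, r2, r⟩ := r
  by_cases h1 : q2 = p1
  · subst h1
    by_cases h2 : r2 = q1
    · subst h2
      simp [PathAlgebra.of_mul_of, pathMul_of_eq, Quiver.Path.comp_assoc]
    · rw [PathAlgebra.of_mul_of, pathMul_of_eq, PathAlgebra.of_mul_of, PathAlgebra.of_mul_of,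
        pathMul_of_ne k (by simpa using h2), pathMul_of_ne k (by simpa using h2), hz']
  · by_cases h2 : r2 = q1
    · subst h2
      rw [PathAlgebra.of_mul_of k ⟨r2, q2, q⟩, pathMul_of_eq, PathAlgebra.of_mul_of,
        PathAlgebra.of_mul_of, pathMul_of_ne k (by simpa using h1),
        pathMul_of_ne k (by simpa using h1), hz]
    · rw [PathAlgebra.of_mul_of, PathAlgebra.of_mul_of, pathMul_of_ne k (by simpa using h1),
        pathMul_of_ne k (by simpa using h2), hz, hz']

theorem PathAlgebra.mulHom_assoc (x y z : PathAlgebra k V) :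
    mulHom k (mulHom k x y) z = mulHom k x (mulHom k y z) := by
  induction x using PathAlgebra.induction_on k with
  | hz => simp
  | hadd x x' hx hx' => simp [hx, hx']
  | hsmul c x hx => simp [hx]
  | hof p =>
    induction y using PathAlgebra.induction_on k with
    | hz => simp
    | hadd y y' hy hy' => simp [hy, hy']
    | hsmul c y hy => simp [hy]
    | hof q =>
      induction z using PathAlgebra.induction_on k with
      | hz => simp
      | hadd z z' hz hz' => simp [hz, hz']
      | hsmul c z hz => simp [hz]
      | hof r => exact PathAlgebra.of_mul_assoc k p q r

theorem PathAlgebra.mulHom_one_left [Fintype V] (x : PathAlgebra k V) : mulHom k 1 x = x := by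
  induction x using PathAlgebra.induction_on k with
  | hz => simp
  | hadd x x' hx hx' => simp [hx, hx']
  | hsmul c x hx => simp [hx]
  | hof p =>
    obtain ⟨p1, p2, p⟩ := p
    simp only [PathAlgebra.one_def, map_sum, LinearMap.sum_apply, PathAlgebra.mulHom_of_of]
    rw [Finset.sum_eq_single p2]
    · exact pathMul_of_eq k p Quiver.Path.nil
    · intro v _ hv
      exact pathMul_of_ne k (by simpa [QPath.triv] using hv.symm)
    · simp

theorem PathAlgebra.mulHom_one_right [Fintype V] (x : PathAlgebra k V) : mulHom k x 1 = x := by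
  induction x using PathAlgebra.induction_on k with
  | hz => simp
  | hadd x x' hx hx' => simp [hx, hx']
  | hsmul c x hx => simp [hx]
  | hof p =>
    obtain ⟨p1, p2, p⟩ := p
    simp only [PathAlgebra.one_def, map_sum, PathAlgebra.mulHom_of_of]
    rw [Finset.sum_eq_single p1]
    · exact (pathMul_of_eq k Quiver.Path.nil p).trans (by rw [Quiver.Path.nil_comp])
    · intro v _ hv
      exact pathMul_of_ne k (by simpa [QPath.triv] using hv)
    · simp

instance [Fintype V] : Ring (PathAlgebra k V) where
  __ := (inferInstance : AddCommGroup (PathAlgebra k V))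
  mul := (· * ·)
  one := 1
  zero_mul x := by simp [PathAlgebra.mul_def]
  mul_zero x := by simp [PathAlgebra.mul_def]
  left_distrib x y z := by simp [PathAlgebra.mul_def]
  right_distrib x y z := by simp [PathAlgebra.mul_def]
  mul_assoc := PathAlgebra.mulHom_assoc k
  one_mul := PathAlgebra.mulHom_one_left k
  mul_one := PathAlgebra.mulHom_one_right k

instance [Fintype V] : Algebra k (PathAlgebra k V) :=
  Algebra.ofModule
    (fun c x y => by simp [PathAlgebra.mul_def])
    (fun c x y => by simp [PathAlgebra.mul_def])

/-- The monomial algebra `kQ / I`, where `I` is the two-sided ideal generated by the set of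
paths `Z`. -/
def MonomialAlgebra [Fintype V] (Z : Set (QPath V)) : Type _ :=
  (TwoSidedIdeal.span (PathAlgebra.of k '' Z)).ringCon.Quotient

instance [Fintype V] (Z : Set (QPath V)) : Ring (MonomialAlgebra k Z) :=
  inferInstanceAs (Ring (TwoSidedIdeal.span (PathAlgebra.of k '' Z)).ringCon.Quotient)

instance [Fintype V] (Z : Set (QPath V)) : Algebra k (MonomialAlgebra k Z) :=
  inferInstanceAs (Algebra k (TwoSidedIdeal.span (PathAlgebra.of k '' Z)).ringCon.Quotient)

/-- The class of a path in the monomial algebra. -/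
def MonomialAlgebra.of [Fintype V] (Z : Set (QPath V)) (p : QPath V) : MonomialAlgebra k Z :=
  (TwoSidedIdeal.span (PathAlgebra.of k '' Z)).ringCon.mk' (PathAlgebra.of k p)

end PathAlgebra

/-! ## First Hochschild cohomology -/

section Hochschild

variable (k : Type*) [Field k] (A : Type*) [Ring A] [Algebra k A]

/-- The Lie algebra of `k`-linear derivations of an associative algebra, with the commutator
bracket. -/
def derivations : LieSubalgebra k (Module.End k A) where
  carrier := {D | ∀ x y : A, D (x * y) = D x * y + x * D y}
  add_mem' {D E} hD hE x y := by
    change ∀ x y : A, D (x * y) = D x * y + x * D y at hD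
    change ∀ x y : A, E (x * y) = E x * y + x * E y at hE
    simp only [LinearMap.add_apply, hD, hE, add_mul, mul_add]
    abel
  zero_mem' x y := by simp
  smul_mem' c D hD x y := by
    change ∀ x y : A, D (x * y) = D x * y + x * D y at hD
    simp [hD]
  lie_mem' {D E} hD hE x y := by
    change ∀ x y : A, D (x * y) = D x * y + x * D y at hD
    change ∀ x y : A, E (x * y) = E x * y + x * E y at hE
    simp only [Ring.lie_def, LinearMap.sub_apply, Module.End.mul_apply, hD, hE, map_add, sub_mul,
      mul_sub]
    abel

/-- The Lie ideal of inner derivations `x ↦ c x - x c`. -/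
def innerDerivations : LieIdeal k (derivations k A) where
  carrier := {D | ∃ c : A, ∀ x : A, (D : Module.End k A) x = c * x - x * c}
  add_mem' := by
    rintro D E ⟨c, hc⟩ ⟨d, hd⟩
    refine ⟨c + d, fun x => ?_⟩
    change D.1 x + E.1 x = _
    rw [hc, hd, add_mul, mul_add]
    abel
  zero_mem' := ⟨0, fun x => by simp⟩
  smul_mem' := by
    rintro r D ⟨c, hc⟩
    exact ⟨r • c, fun x => by simp [hc, smul_sub]⟩
  lie_mem := by
    rintro E D ⟨c, hc⟩
    refine ⟨(E : Module.End k A) c, fun x => ?_⟩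
    have hE : ∀ x y : A, (E : Module.End k A) (x * y) =
      (E : Module.End k A) x * y + x * (E : Module.End k A) y := E.2
    simp only [LieSubalgebra.coe_bracket, Ring.lie_def, LinearMap.sub_apply,
      Module.End.mul_apply, hc, map_sub, hE]
    abel

/-- The first Hochschild cohomology `HH¹(A)`: derivations modulo inner derivations, a Lie algebra
for the commutator bracket. -/
def HH1 : Type _ := derivations k A ⧸ innerDerivations k A

instance : LieRing (HH1 k A) := inferInstanceAs (LieRing (derivations k A ⧸ innerDerivations k A))

instance : LieAlgebra k (HH1 k A) :=
  inferInstanceAs (LieAlgebra k (derivations k A ⧸ innerDerivations k A))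

/-- The class of a derivation in `HH¹(A)`, as a linear map. -/
def HH1.mk : derivations k A →ₗ[k] HH1 k A :=
  (LieSubmodule.Quotient.mk' (innerDerivations k A) :
    derivations k A →ₗ[k] derivations k A ⧸ innerDerivations k A)

end Hochschild

/-! ## Gluing two arrows -/

section Gluing

/-- A source arrow: its starting vertex is a source, and no other arrow starts where it starts or
ends where it ends. -/
def IsSourceArrow {V : Type*} [Quiver V] (a : Quiver.Total V) : Prop :=
  (∀ b : Quiver.Total V, b.right ≠ a.left) ∧
    ∀ b : Quiver.Total V, b ≠ a → b.left ≠ a.left ∧ b.right ≠ a.right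

/-- A sink arrow: its ending vertex is a sink, and no other arrow starts where it starts or ends
where it ends. -/
def IsSinkArrow {V : Type*} [Quiver V] (a : Quiver.Total V) : Prop :=
  (∀ b : Quiver.Total V, b.left ≠ a.right) ∧
    ∀ b : Quiver.Total V, b ≠ a → b.left ≠ a.left ∧ b.right ≠ a.right

/-- The four end points of the two arrows are pairwise different. -/
def EndpointsDistinct {V : Type*} [Quiver V] (α β : Quiver.Total V) : Prop :=
  [α.left, α.right, β.left, β.right].Nodup

/-- The two arrows lie in the same connected component of the quiver, that is, in the same block
of the algebra. -/
def SameBlock {V : Type*} [Quiver V] (α β : Quiver.Total V) : Prop :=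
  Quiver.WeaklyConnectedComponent.mk α.left = Quiver.WeaklyConnectedComponent.mk β.left

variable (k : Type*) [Field k] {V : Type*} [Quiver V] [Fintype V]
  (Z : Set (QPath V)) (α β : Quiver.Total V)

/-- The idempotent of `A` given by the vertex of `Q_B` which is the image of `v`: the sum
`s(α) + s(β)`, or `t(α) + t(β)`, or `v` itself. -/
def vertexVal (v : V) : MonomialAlgebra k Z :=
  open Classical in
  if v = α.left ∨ v = β.left then
    MonomialAlgebra.of k Z (QPath.triv α.left) + MonomialAlgebra.of k Z (QPath.triv β.left)
  else if v = α.right ∨ v = β.right then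
    MonomialAlgebra.of k Z (QPath.triv α.right) + MonomialAlgebra.of k Z (QPath.triv β.right)
  else MonomialAlgebra.of k Z (QPath.triv v)

/-- The element of `A` given by the arrow of `Q_B` which is the image of `a`: the sum
`γ* = α + β` if `a` is `α` or `β`, and `a` itself otherwise. -/
def arrowVal (a : Quiver.Total V) : MonomialAlgebra k Z :=
  open Classical in
  if a = α ∨ a = β then
    MonomialAlgebra.of k Z (QPath.arrow α) + MonomialAlgebra.of k Z (QPath.arrow β)
  else MonomialAlgebra.of k Z (QPath.arrow a)

/-- The algebra `B` obtained from `A = kQ_A / I_A` by gluing the arrows `α` and `β`. -/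
def gluedAlgebra : Subalgebra k (MonomialAlgebra k Z) :=
  Algebra.adjoin k (Set.range (vertexVal k Z α β) ∪ Set.range (arrowVal k Z α β))

/-- The image `v*` in `B` of a vertex `v` of `Q_A`. -/
def starVertex (v : V) : gluedAlgebra k Z α β :=
  ⟨vertexVal k Z α β v, Algebra.subset_adjoin (Or.inl ⟨v, rfl⟩)⟩

/-- The image `a*` in `B` of an arrow `a` of `Q_A`. -/
def starArrow (a : Quiver.Total V) : gluedAlgebra k Z α β :=
  ⟨arrowVal k Z α β a, Algebra.subset_adjoin (Or.inr ⟨a, rfl⟩)⟩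

/-- The image in `B` of a path of `Q_A`. -/
def starPathAux {u : V} : {v : V} → Quiver.Path u v → gluedAlgebra k Z α β
  | _, Quiver.Path.nil => starVertex k Z α β u
  | _, Quiver.Path.cons (b := x) (c := y) p a => starArrow k Z α β ⟨x, y, a⟩ * starPathAux p

/-- The image `p*` in `B` of a path `p` of `Q_A`. -/
def starPath (p : QPath V) : gluedAlgebra k Z α β := starPathAux k Z α β p.path

/-- The contribution of the arrow `a` to `ψ₁(δ_A⁰(e ‖ p))`, where `p` is a cycle at `e`: the
element `(ap)*` if `s(a) = e` and `ap ∉ I_A`, minus `(pa)*` if `t(a) = e` and `pa ∉ I_A`. -/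
def pushTerm (p : QPath V) (a : Quiver.Total V) : gluedAlgebra k Z α β :=
  open Classical in
  (if MonomialAlgebra.of k Z (QPath.arrow a) * MonomialAlgebra.of k Z p ≠ 0 then
      starArrow k Z α β a * starPath k Z α β p else 0) -
    (if MonomialAlgebra.of k Z p * MonomialAlgebra.of k Z (QPath.arrow a) ≠ 0 then
      starPath k Z α β p * starArrow k Z α β a else 0)

/-- The cochain `ψ₁(δ_A⁰(e ‖ p))`, where `p` is a cycle at `e`. A linear combination
`∑ c • (b ‖ q)` of parallel pairs of an arrow `b` and a basis path `q` of `B` is written as the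
function `b ↦ ∑ c • q` with values in `B`; an arrow of `Q_B` is given by a preimage in `Q_A`, so
that `α` and `β` have the same value, the sum of the contributions of both. -/
def pushCoboundary (p : QPath V) : Quiver.Total V → gluedAlgebra k Z α β := fun a =>
  open Classical in
  if a = α ∨ a = β then pushTerm k Z α β p α + pushTerm k Z α β p β
  else pushTerm k Z α β p a

/-- The cochain `δ_B⁰(f ‖ y)`, where `y` is a cycle of `Q_B` at `f`: it is `b ↦ by - yb`. -/
def deltaZero (y : gluedAlgebra k Z α β) : Quiver.Total V → gluedAlgebra k Z α β := fun a =>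
  starArrow k Z α β a * y - y * starArrow k Z α β a

/-- The special paths between `α` and `β`: the paths `p ∉ I_A` of positive length between the
starting vertices of `α` and `β`, or between their ending vertices (in either direction), with
`δ_B⁰(f ‖ p*) ≠ 0`. -/
def specialPaths : Set (QPath V) :=
  {p | MonomialAlgebra.of k Z p ≠ 0 ∧ 1 ≤ p.path.length ∧
    ((p.src = α.left ∧ p.tgt = β.left) ∨ (p.src = β.left ∧ p.tgt = α.left) ∨
      (p.src = α.right ∧ p.tgt = β.right) ∨ (p.src = β.right ∧ p.tgt = α.right)) ∧
    deltaZero k Z α β (starPath k Z α β p) ≠ 0}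

/-- The space `Z_sp(α, β)` spanned by the `δ_B⁰(f ‖ p*)`, where `p` is a special path. -/
def specialSpace : Submodule k (Quiver.Total V → gluedAlgebra k Z α β) :=
  Submodule.span k ((fun p => deltaZero k Z α β (starPath k Z α β p)) '' specialPaths k Z α β)

/-- The space `Y = ψ₁(Im δ_A⁰) + Z_sp(α, β)` of cochains of `B`. -/
def cochainY : Submodule k (Quiver.Total V → gluedAlgebra k Z α β) :=
  Submodule.span k (pushCoboundary k Z α β ''
    {p | p.src = p.tgt ∧ MonomialAlgebra.of k Z p ≠ 0}) ⊔ specialSpace k Z α β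

/-- The derivations of `B` given by `Y`: a cocycle `x` corresponds to the derivation that kills
the vertices and is `x` on the arrows. -/
def derivationY : Submodule k (derivations k (gluedAlgebra k Z α β)) where
  carrier := {D | (∀ v, D.1 (starVertex k Z α β v) = 0) ∧
    (fun a => D.1 (starArrow k Z α β a)) ∈ cochainY k Z α β}
  add_mem' {D E} hD hE := ⟨fun v => by simp [hD.1 v, hE.1 v], add_mem hD.2 hE.2⟩
  zero_mem' := ⟨fun v => by simp, zero_mem (cochainY k Z α β)⟩
  smul_mem' c D hD := ⟨fun v => by simp [hD.1 v], Submodule.smul_mem _ c hD.2⟩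

/-- The subspace `I = Y / Im δ_B⁰` of `HH¹(B)`. -/
def gluingIdeal : Submodule k (HH1 k (gluedAlgebra k Z α β)) :=
  (derivationY k Z α β).map (HH1.mk k (gluedAlgebra k Z α β))

/-- The derivation `D` of `B` is `γ* ‖ γ*`: it fixes `γ*` and kills the vertices and all other
arrows. -/
def IsGammaDerivation (D : derivations k (gluedAlgebra k Z α β)) : Prop :=
  (∀ v, D.1 (starVertex k Z α β v) = 0) ∧
    D.1 (starArrow k Z α β α) = starArrow k Z α β α ∧
    ∀ a, a ≠ α → a ≠ β → D.1 (starArrow k Z α β a) = 0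

end Gluing

end ArrowGluing

end

/-! Write e_1, e_2 for the ends of `α` and e_{n-1}, e_n for those of `β`. A derivation D of B
killing the idempotents f_i is transported to A by cutting with vertices of A: a path p from u to v
goes to e_v D(p*) e_u (`pullDerivation`). This is a derivation of A killing the vertices, because
cutting p* at either end gives back p. Up to inner derivations, all derivations of A and of B kill
the vertices, so it suffices to study this map.

It respects brackets (`pullDerivation_lie`). The only corner in which D(γ*) can have a component
invisible to the transported derivation runs from e_1 to e_n. No arrow lies in that corner, and a
product lying outside it never passes through it, because e_1 is a source and e_n is a sink.

It is onto modulo inner derivations (`exists_pullDerivation_mk_eq`). A derivation of A killing the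
vertices only scales `α` and `β`, and the inner derivation of -s e_1 + t e_n scales them by s and t
and kills the other arrows. After subtracting it, the derivation kills `α` and `β` and therefore
restricts to B.

An inner derivation of B goes to one given by some w with equal coefficients at e_1 and e_{n-1}.
Conversely, if D goes to the inner derivation of such a w, then D is inner
(`inner_of_pullDerivation_inner`): w lies in B, and the discrepancy in the corner from e_1 to e_n
factors through `α`, so it is absorbed by adding to w an element from e_2 to e_n.

The one remaining obstruction, the difference of the coefficients of w at e_{n-1} and e_1, extends
to a functional on derivations that vanishes on brackets (`exists_lie_functional`). For an arrow
from s to t, the trace on e_t A e_s divided by the dimension of that corner sends the inner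
derivation of w to w_t - w_s. Characteristic 0 permits the division, and a walk from e_1 to e_{n-1},
which exists within one block, adds up these differences.

The transport together with this functional identifies HH¹(B) with HH¹(A) × k. The derivation γ*‖γ*
becomes inner by -e_1 + e_n and has functional value 1, so its class is (0, 1), which is central.
Every cochain in Y agrees on the unglued arrows with an inner derivation of A and hence has first
coordinate 0, so I is exactly that line. -/

noncomputable section

namespace ArrowGluing

/-! ### The path basis of a monomial algebra and its corners -/

section Basis

variable (k : Type*) [Field k] {V : Type*} [Quiver V] [Fintype V] (Z : Set (QPath V))

/-- The projection of the path algebra onto the monomial algebra. -/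
def MonomialAlgebra.proj : PathAlgebra k V →ₗ[k] MonomialAlgebra k Z where
  toFun := (TwoSidedIdeal.span (PathAlgebra.of k '' Z)).ringCon.mk'
  map_add' := map_add _
  map_smul' _ _ := rfl

theorem MonomialAlgebra.proj_of (p : QPath V) :
    proj k Z (PathAlgebra.of k p) = MonomialAlgebra.of k Z p := rfl

theorem MonomialAlgebra.proj_surjective : Function.Surjective (proj k Z) :=
  Quotient.mk_surjective

theorem MonomialAlgebra.proj_eq_zero_iff (x : PathAlgebra k V) :
    proj k Z x = 0 ↔ x ∈ TwoSidedIdeal.span (PathAlgebra.of k '' Z) := by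
  rw [TwoSidedIdeal.mem_iff]
  exact Quotient.eq (r := (TwoSidedIdeal.span (PathAlgebra.of k '' Z)).ringCon.toSetoid)

theorem MonomialAlgebra.proj_mul (x y : PathAlgebra k V) :
    proj k Z (x * y) = proj k Z x * proj k Z y := rfl

theorem MonomialAlgebra.proj_one : proj k Z 1 = 1 := rfl

theorem MonomialAlgebra.of_mul_of {u v w : V} (q : Quiver.Path u v) (p : Quiver.Path v w) :
    MonomialAlgebra.of k Z ⟨v, w, p⟩ * MonomialAlgebra.of k Z ⟨u, v, q⟩ =
      MonomialAlgebra.of k Z ⟨u, w, q.comp p⟩ := by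
  rw [← proj_of, ← proj_of, ← proj_of, ← proj_mul, PathAlgebra.of_mul_of, pathMul_of_eq]

theorem MonomialAlgebra.of_mul_of_ne {p q : QPath V} (h : q.tgt ≠ p.src) :
    MonomialAlgebra.of k Z p * MonomialAlgebra.of k Z q = 0 := by
  rw [← proj_of, ← proj_of, ← proj_mul, PathAlgebra.of_mul_of, pathMul_of_ne k h, map_zero]

theorem MonomialAlgebra.sum_of_triv :
    ∑ v : V, MonomialAlgebra.of k Z (QPath.triv v) = 1 := by
  rw [← proj_one, PathAlgebra.one_def, map_sum]
  rfl

theorem MonomialAlgebra.span_range_of :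
    Submodule.span k (Set.range (MonomialAlgebra.of k Z)) = ⊤ := by
  have h := (PathAlgebra.basis k (V := V)).span_eq
  apply_fun Submodule.map (proj k Z) at h
  rw [Submodule.map_span, Submodule.map_top,
    LinearMap.range_eq_top.mpr (proj_surjective k Z), ← Set.range_comp] at h
  exact h

/-- A set of paths closed under extension to both sides spans a two-sided ideal. -/
theorem span_le_span_of_absorbing (P : Set (QPath V)) (hZ : Z ⊆ P)
    (hP : ∀ (u v w : V) (q : Quiver.Path u v) (p : Quiver.Path v w),
      (⟨u, v, q⟩ : QPath V) ∈ P ∨ (⟨v, w, p⟩ : QPath V) ∈ P → (⟨u, w, q.comp p⟩ : QPath V) ∈ P)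
    {x : PathAlgebra k V} (hx : x ∈ TwoSidedIdeal.span (PathAlgebra.of k '' Z)) :
    x ∈ Submodule.span k (PathAlgebra.of k '' P) := by
  set S := Submodule.span k (PathAlgebra.of k '' P) with hS
  have hpq : ∀ p q : QPath V, p ∈ P ∨ q ∈ P → PathAlgebra.of k p * PathAlgebra.of k q ∈ S := by
    rintro ⟨v, w, p⟩ ⟨u, v', q⟩ h
    by_cases hv : v' = v
    · subst hv
      rw [PathAlgebra.of_mul_of, pathMul_of_eq]
      exact Submodule.subset_span ⟨_, hP _ _ _ _ _ h.symm, rfl⟩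
    · rw [PathAlgebra.of_mul_of, pathMul_of_ne k (by simpa using hv)]
      exact zero_mem _
  have hl : ∀ x y : PathAlgebra k V, y ∈ S → x * y ∈ S := by
    intro x y hy
    induction x using PathAlgebra.induction_on k with
    | hz => simp
    | hadd x x' hx hx' => rw [add_mul]; exact add_mem hx hx'
    | hsmul c x hx => rw [smul_mul_assoc]; exact S.smul_mem c hx
    | hof p =>
      induction hy using Submodule.span_induction with
      | mem y h => obtain ⟨q, hq, rfl⟩ := h; exact hpq p q (Or.inr hq)
      | zero => simp
      | add y y' _ _ hy hy' => rw [mul_add]; exact add_mem hy hy'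
      | smul c y _ hy => rw [mul_smul_comm]; exact S.smul_mem c hy
  have hr : ∀ x y : PathAlgebra k V, x ∈ S → x * y ∈ S := by
    intro x y hx
    induction y using PathAlgebra.induction_on k with
    | hz => simp
    | hadd x x' hx hx' => rw [mul_add]; exact add_mem hx hx'
    | hsmul c x hx => rw [mul_smul_comm]; exact S.smul_mem c hx
    | hof p =>
      induction hx using Submodule.span_induction with
      | mem y h => obtain ⟨q, hq, rfl⟩ := h; exact hpq q p (Or.inl hq)
      | zero => simp
      | add y y' _ _ hy hy' => rw [add_mul]; exact add_mem hy hy'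
      | smul c y _ hy => rw [smul_mul_assoc]; exact S.smul_mem c hy
  have hle : TwoSidedIdeal.span (PathAlgebra.of k '' Z) ≤
      TwoSidedIdeal.mk' (S : Set (PathAlgebra k V)) (zero_mem S) add_mem neg_mem
        (hl _ _) (hr _ _) := by
    rw [TwoSidedIdeal.span_le, TwoSidedIdeal.coe_mk']
    rintro _ ⟨p, hp, rfl⟩
    exact Submodule.subset_span ⟨p, hZ hp, rfl⟩
  have := hle hx
  rwa [TwoSidedIdeal.mem_mk'] at this

theorem PathAlgebra.repr_eq_zero_of_mem_span {P : Set (QPath V)} {x : PathAlgebra k V}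
    (hx : x ∈ Submodule.span k (PathAlgebra.of k '' P)) {p : QPath V} (hp : p ∉ P) :
    (PathAlgebra.basis k).repr x p = 0 := by
  by_contra h
  exact hp ((PathAlgebra.basis k).mem_span_image.mp hx (Finsupp.mem_support_iff.mpr h))

-- Extending a path of length at least 2 keeps it that long, so the whole ideal lies in the span of
-- such paths and no vertex or arrow is lost.
variable {Z} in
theorem MonomialAlgebra.of_ne_zero (hZ : ∀ p ∈ Z, 2 ≤ p.path.length) (p : QPath V)
    (hp : p.path.length < 2) : MonomialAlgebra.of k Z p ≠ 0 := by
  intro h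
  rw [← proj_of, proj_eq_zero_iff] at h
  have h1 := span_le_span_of_absorbing k Z {p | 2 ≤ p.path.length} hZ
    (by
      intro u v w q p h
      simp only [Set.mem_ofPred_eq, Quiver.Path.length_comp] at h ⊢
      omega) h
  have h2 := PathAlgebra.repr_eq_zero_of_mem_span k h1 (p := p) (by simpa using hp)
  simp [PathAlgebra.of] at h2

/-- The paths which are non-zero in the monomial algebra. -/
abbrev NonzeroPath : Type _ := {p : QPath V // MonomialAlgebra.of k Z p ≠ 0}

/-- The paths vanishing in the quotient contain the relations and absorb extension, so they span the
ideal. A combination of the other paths that lies in the ideal then has empty support. -/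
theorem MonomialAlgebra.linearIndependent_of :
    LinearIndependent k fun p : NonzeroPath k Z => MonomialAlgebra.of k Z p.1 := by
  have h1 : LinearIndependent k fun p : NonzeroPath k Z => PathAlgebra.of k p.1 :=
    (PathAlgebra.basis k (V := V)).linearIndependent.comp _ Subtype.val_injective
  refine h1.map (f := proj k Z) ?_
  rw [Submodule.disjoint_def]
  intro x hx hx0
  rw [LinearMap.mem_ker, proj_eq_zero_iff] at hx0
  have h2 := span_le_span_of_absorbing k Z {p | MonomialAlgebra.of k Z p = 0}
    (fun p hp => by
      rw [Set.mem_ofPred_eq, ← proj_of, proj_eq_zero_iff]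
      exact TwoSidedIdeal.subset_span ⟨p, hp, rfl⟩)
    (by
      intro u v w q p h
      simp only [Set.mem_ofPred_eq] at h ⊢
      rw [← of_mul_of]
      rcases h with h | h <;> simp [h]) hx0
  have h3 : x ∈ Submodule.span k
      (PathAlgebra.of k '' {p | MonomialAlgebra.of k Z p ≠ 0}) := by
    rw [Set.image_eq_range]
    exact hx
  apply (PathAlgebra.basis k).repr.injective
  ext p
  rw [map_zero, Finsupp.zero_apply]
  by_cases hp : MonomialAlgebra.of k Z p = 0
  · exact PathAlgebra.repr_eq_zero_of_mem_span k h3 (by simpa using hp)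
  · exact PathAlgebra.repr_eq_zero_of_mem_span k h2 (by simpa using hp)

/-- The basis of a monomial algebra given by the non-zero paths. -/
def MonomialAlgebra.basis : Module.Basis (NonzeroPath k Z) k (MonomialAlgebra k Z) :=
  Module.Basis.mk (linearIndependent_of k Z) (by
    rw [← span_range_of k Z, Submodule.span_le]
    rintro _ ⟨p, rfl⟩
    by_cases hp : MonomialAlgebra.of k Z p = 0
    · rw [hp]; exact zero_mem _
    · exact Submodule.subset_span ⟨⟨p, hp⟩, rfl⟩)

theorem MonomialAlgebra.basis_apply (p : NonzeroPath k Z) :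
    basis k Z p = MonomialAlgebra.of k Z p.1 := by
  simp [basis]

variable {k Z}

@[elab_as_elim]
theorem MonomialAlgebra.induction_on {P : MonomialAlgebra k Z → Prop} (x : MonomialAlgebra k Z)
    (zero : P 0) (add : ∀ x y, P x → P y → P (x + y)) (smul : ∀ (c : k) x, P x → P (c • x))
    (of : ∀ (u v : V) (p : Quiver.Path u v), P (MonomialAlgebra.of k Z ⟨u, v, p⟩)) : P x := by
  have hx : x ∈ Submodule.span k (Set.range (MonomialAlgebra.of k Z)) := by
    rw [span_range_of]; trivial
  induction hx using Submodule.span_induction with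
  | mem x h =>
    obtain ⟨p, rfl⟩ := h
    exact of p.src p.tgt p.path
  | zero => exact zero
  | add x y _ _ hx hy => exact add x y hx hy
  | smul c x _ hx => exact smul c x hx

/-- The coefficient of a path in an element of a monomial algebra. -/
def MonomialAlgebra.coeff (p : QPath V) (hp : MonomialAlgebra.of k Z p ≠ 0) :
    MonomialAlgebra k Z →ₗ[k] k :=
  (basis k Z).coord ⟨p, hp⟩

theorem MonomialAlgebra.coeff_of_self (p : QPath V) (hp : MonomialAlgebra.of k Z p ≠ 0) :
    coeff p hp (MonomialAlgebra.of k Z p) = 1 := by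
  rw [← basis_apply k Z ⟨p, hp⟩, coeff, Module.Basis.coord_apply, Module.Basis.repr_self,
    Finsupp.single_eq_same]

theorem MonomialAlgebra.coeff_of_ne (p : QPath V) (hp : MonomialAlgebra.of k Z p ≠ 0)
    {q : QPath V} (h : q ≠ p) : coeff p hp (MonomialAlgebra.of k Z q) = 0 := by
  by_cases hq : MonomialAlgebra.of k Z q = 0
  · rw [hq, map_zero]
  · rw [← basis_apply k Z ⟨q, hq⟩, coeff, Module.Basis.coord_apply, Module.Basis.repr_self,
      Finsupp.single_eq_of_ne (by simpa using h.symm)]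

/-- The idempotent given by a vertex. -/
abbrev MonomialAlgebra.vertex (k : Type*) [Field k] {V : Type*} [Quiver V] [Fintype V]
    (Z : Set (QPath V)) (v : V) : MonomialAlgebra k Z := MonomialAlgebra.of k Z (QPath.triv v)

open MonomialAlgebra

theorem MonomialAlgebra.of_mul_vertex {u v : V} (p : Quiver.Path u v) :
    MonomialAlgebra.of k Z ⟨u, v, p⟩ * vertex k Z u = MonomialAlgebra.of k Z ⟨u, v, p⟩ := by
  exact (of_mul_of k Z Quiver.Path.nil p).trans (by rw [Quiver.Path.nil_comp])

theorem MonomialAlgebra.vertex_mul_of {u v : V} (p : Quiver.Path u v) :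
    vertex k Z v * MonomialAlgebra.of k Z ⟨u, v, p⟩ = MonomialAlgebra.of k Z ⟨u, v, p⟩ :=
  of_mul_of k Z p Quiver.Path.nil

theorem MonomialAlgebra.of_mul_vertex_of_ne {u v w : V} (p : Quiver.Path u v) (h : w ≠ u) :
    MonomialAlgebra.of k Z ⟨u, v, p⟩ * vertex k Z w = 0 :=
  of_mul_of_ne k Z (by simpa [QPath.triv] using h)

theorem MonomialAlgebra.vertex_mul_of_of_ne {u v w : V} (p : Quiver.Path u v) (h : w ≠ v) :
    vertex k Z w * MonomialAlgebra.of k Z ⟨u, v, p⟩ = 0 :=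
  of_mul_of_ne k Z (by simpa [QPath.triv] using h.symm)

theorem MonomialAlgebra.vertex_mul_self (v : V) : vertex k Z v * vertex k Z v = vertex k Z v :=
  vertex_mul_of Quiver.Path.nil

theorem MonomialAlgebra.vertex_mul_vertex_of_ne {v w : V} (h : v ≠ w) :
    vertex k Z v * vertex k Z w = 0 :=
  vertex_mul_of_of_ne Quiver.Path.nil h

/-- An element of the form `e_v x e_u` lies in every subspace containing the paths from `u` to
`v`. -/
theorem MonomialAlgebra.corner_mem {u v : V} (W : Submodule k (MonomialAlgebra k Z))
    (hW : ∀ p : Quiver.Path u v, MonomialAlgebra.of k Z ⟨u, v, p⟩ ∈ W) (x : MonomialAlgebra k Z) :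
    vertex k Z v * x * vertex k Z u ∈ W := by
  induction x using MonomialAlgebra.induction_on with
  | zero => simp
  | add x y hx hy => rw [mul_add, add_mul]; exact add_mem hx hy
  | smul c x hx => rw [mul_smul_comm, smul_mul_assoc]; exact W.smul_mem c hx
  | of u' v' p =>
    by_cases hu : u = u'
    · subst hu
      by_cases hv : v = v'
      · subst hv
        rw [vertex_mul_of, of_mul_vertex]
        exact hW p
      · rw [vertex_mul_of_of_ne p hv, zero_mul]
        exact zero_mem W
    · rw [mul_assoc, of_mul_vertex_of_ne p hu, mul_zero]
      exact zero_mem W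

theorem MonomialAlgebra.sum_vertex_mul (x : MonomialAlgebra k Z) :
    ∑ v, vertex k Z v * x = x := by
  rw [← Finset.sum_mul, sum_of_triv, one_mul]

theorem MonomialAlgebra.sum_mul_vertex (x : MonomialAlgebra k Z) :
    ∑ v, x * vertex k Z v = x := by
  rw [← Finset.mul_sum, sum_of_triv, mul_one]

/-- Elements agree as soon as their corners do. -/
theorem MonomialAlgebra.ext_corner {x y : MonomialAlgebra k Z}
    (h : ∀ u v, vertex k Z v * x * vertex k Z u = vertex k Z v * y * vertex k Z u) : x = y := by
  rw [← sum_vertex_mul x, ← sum_vertex_mul y]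
  refine Finset.sum_congr rfl fun v _ => ?_
  rw [← sum_mul_vertex (vertex k Z v * x), ← sum_mul_vertex (vertex k Z v * y)]
  exact Finset.sum_congr rfl fun u _ => h u v

theorem MonomialAlgebra.mul_eq_sum (x y : MonomialAlgebra k Z) :
    x * y = ∑ v, x * vertex k Z v * (vertex k Z v * y) := by
  conv_lhs => rw [← sum_vertex_mul y, Finset.mul_sum]
  refine Finset.sum_congr rfl fun v _ => ?_
  rw [mul_assoc, ← mul_assoc (vertex k Z v) (vertex k Z v), vertex_mul_self]

end Basis

/-! ### Coefficients of vertices and arrows -/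

section Coefficients

variable {k : Type*} [Field k] {V : Type*} [Quiver V] [Fintype V] {Z : Set (QPath V)}
  (hZ : ∀ p ∈ Z, 2 ≤ p.path.length)

open MonomialAlgebra

/-- The coefficient of the trivial path at a vertex. -/
def vertexCoeff (v : V) : MonomialAlgebra k Z →ₗ[k] k :=
  coeff (QPath.triv v) (of_ne_zero k hZ _ (by simp [QPath.triv]))

/-- The coefficient of an arrow. -/
def arrowCoeff (a : Quiver.Total V) : MonomialAlgebra k Z →ₗ[k] k :=
  coeff (QPath.arrow a) (of_ne_zero k hZ _ (by simp [QPath.arrow]))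

theorem vertexCoeff_vertex_self (v : V) : vertexCoeff hZ v (vertex k Z v) = 1 :=
  coeff_of_self _ _

theorem vertexCoeff_vertex_of_ne {v w : V} (h : w ≠ v) :
    vertexCoeff hZ v (vertex k Z w) = 0 :=
  coeff_of_ne _ _ (fun h' => h (congrArg QPath.src h'))

theorem vertexCoeff_of_pos (v : V) (p : QPath V) (hp : 0 < p.path.length) :
    vertexCoeff hZ v (MonomialAlgebra.of k Z p) = 0 :=
  coeff_of_ne _ _ (by rintro rfl; simp [QPath.triv] at hp)

theorem arrowCoeff_arrow_self (a : Quiver.Total V) :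
    arrowCoeff hZ a (MonomialAlgebra.of k Z (QPath.arrow a)) = 1 :=
  coeff_of_self _ _

theorem QPath.arrow_injective {V : Type*} [Quiver V] :
    Function.Injective (QPath.arrow : Quiver.Total V → QPath V) := by
  rintro ⟨u, v, a⟩ ⟨u', v', b⟩ h
  obtain rfl : u = u' := congrArg QPath.src h
  obtain rfl : v = v' := congrArg QPath.tgt h
  simp only [QPath.arrow, QPath.mk.injEq, heq_eq_eq, true_and] at h
  rw [Quiver.Hom.toPath, Quiver.Hom.toPath] at h
  cases h
  rfl

theorem arrowCoeff_arrow_of_ne {a b : Quiver.Total V} (h : b ≠ a) :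
    arrowCoeff hZ a (MonomialAlgebra.of k Z (QPath.arrow b)) = 0 :=
  coeff_of_ne _ _ (fun h' => h (QPath.arrow_injective h'))

theorem arrowCoeff_vertex (a : Quiver.Total V) (v : V) :
    arrowCoeff hZ a (vertex k Z v) = 0 :=
  coeff_of_ne _ _ (fun h => by
    have := congrArg (fun p : QPath V => p.path.length) h
    simp [QPath.triv, QPath.arrow] at this)

theorem arrowCoeff_of_two_le (a : Quiver.Total V) (p : QPath V) (hp : 2 ≤ p.path.length) :
    arrowCoeff hZ a (MonomialAlgebra.of k Z p) = 0 :=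
  coeff_of_ne _ _ (by rintro rfl; simp [QPath.arrow] at hp)

/-- Multiplying p by a path of positive length makes it longer, so only the trivial part of w at the
end of p contributes. This gives the diagonal entries of inner derivations. -/
theorem coeff_mul_of {u v : V} (p : Quiver.Path u v)
    (hp : MonomialAlgebra.of k Z ⟨u, v, p⟩ ≠ 0) (w : MonomialAlgebra k Z) :
    coeff ⟨u, v, p⟩ hp (w * MonomialAlgebra.of k Z ⟨u, v, p⟩) = vertexCoeff hZ v w := by
  induction w using MonomialAlgebra.induction_on with
  | zero => simp
  | add x y hx hy => rw [add_mul, map_add, map_add, hx, hy]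
  | smul c x hx => rw [smul_mul_assoc, map_smul, map_smul, hx]
  | of a b q =>
    by_cases h : v = a
    · subst h
      rw [of_mul_of]
      cases q with
      | nil =>
        exact (coeff_of_self _ _).trans (vertexCoeff_vertex_self hZ v).symm
      | cons q c =>
        rw [vertexCoeff_of_pos _ _ _ (by simp)]
        refine coeff_of_ne _ _ fun h => ?_
        have := congrArg (fun p : QPath V => p.path.length) h
        simp at this
        omega
    · rw [of_mul_of_ne k Z h, map_zero]
      exact (coeff_of_ne _ _ (fun h' => h (congrArg QPath.src h').symm)).symm

theorem coeff_of_mul {u v : V} (p : Quiver.Path u v)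
    (hp : MonomialAlgebra.of k Z ⟨u, v, p⟩ ≠ 0) (w : MonomialAlgebra k Z) :
    coeff ⟨u, v, p⟩ hp (MonomialAlgebra.of k Z ⟨u, v, p⟩ * w) = vertexCoeff hZ u w := by
  induction w using MonomialAlgebra.induction_on with
  | zero => simp
  | add x y hx hy => rw [mul_add, map_add, map_add, hx, hy]
  | smul c x hx => rw [mul_smul_comm, map_smul, map_smul, hx]
  | of a b q =>
    by_cases h : b = u
    · subst h
      rw [of_mul_of]
      cases q with
      | nil =>
        rw [Quiver.Path.nil_comp]
        exact (coeff_of_self _ _).trans (vertexCoeff_vertex_self hZ a).symm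
      | cons q c =>
        rw [vertexCoeff_of_pos _ _ _ (by simp)]
        refine coeff_of_ne _ _ fun h => ?_
        have := congrArg (fun p : QPath V => p.path.length) h
        simp at this
    · rw [of_mul_of_ne k Z h, map_zero]
      exact (coeff_of_ne _ _ (fun h' => h (congrArg QPath.tgt h'))).symm

/-- The paths of positive length span an ideal and the vertices are orthogonal idempotents, so the
coefficient at a vertex is a character. -/
theorem vertexCoeff_mul (v : V) (x y : MonomialAlgebra k Z) :
    vertexCoeff hZ v (x * y) = vertexCoeff hZ v x * vertexCoeff hZ v y := by
  induction y using MonomialAlgebra.induction_on with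
  | zero => simp
  | add y y' hy hy' => rw [mul_add, map_add, map_add, hy, hy', mul_add]
  | smul c y hy => rw [mul_smul_comm, map_smul, map_smul, hy, smul_eq_mul, smul_eq_mul]; ring
  | of a b q =>
    cases q with
    | nil =>
      by_cases h : a = v
      · subst h
        exact (coeff_mul_of hZ Quiver.Path.nil _ x).trans
          (by rw [← QPath.triv, vertexCoeff_vertex_self, mul_one])
      · rw [← QPath.triv, vertexCoeff_vertex_of_ne hZ h, mul_zero]
        induction x using MonomialAlgebra.induction_on with
        | zero => simp
        | add x x' hx hx' => rw [add_mul, map_add, hx, hx', add_zero]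
        | smul c x hx => rw [smul_mul_assoc, map_smul, hx, smul_zero]
        | of a' b' p =>
          by_cases h' : a = a'
          · subst h'
            rw [of_mul_vertex]
            exact coeff_of_ne _ _ (fun h' => h (congrArg QPath.src h'))
          · rw [of_mul_vertex_of_ne p h', map_zero]
    | cons q c =>
      rw [vertexCoeff_of_pos _ _ _ (by simp), mul_zero]
      induction x using MonomialAlgebra.induction_on with
      | zero => simp
      | add x x' hx hx' => rw [add_mul, map_add, hx, hx', add_zero]
      | smul c x hx => rw [smul_mul_assoc, map_smul, hx, smul_zero]
      | of a' b' p =>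
        by_cases h' : b = a'
        · subst h'
          rw [of_mul_of]
          exact vertexCoeff_of_pos _ _ _ (by simp)
        · rw [of_mul_of_ne k Z h', map_zero]

/-- An arrow factors only as a vertex times itself or itself times a vertex. The arrow coefficient
is thus a derivation along the characters at its two ends. -/
theorem arrowCoeff_mul (a : Quiver.Total V) (x y : MonomialAlgebra k Z) :
    arrowCoeff hZ a (x * y) =
      vertexCoeff hZ a.right x * arrowCoeff hZ a y +
        arrowCoeff hZ a x * vertexCoeff hZ a.left y := by
  induction x using MonomialAlgebra.induction_on with
  | zero => simp
  | add x x' hx hx' =>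
    simp only [add_mul, map_add, hx, hx']
    ring
  | smul c x hx =>
    simp only [smul_mul_assoc, map_smul, hx, smul_eq_mul]
    ring
  | of u v p =>
    induction y using MonomialAlgebra.induction_on with
    | zero => simp
    | add y y' hy hy' =>
      simp only [mul_add, map_add, hy, hy']
      ring
    | smul c y hy =>
      simp only [mul_smul_comm, map_smul, hy, smul_eq_mul]
      ring
    | of u' v' q =>
      have hr : ∀ (w : V) {u v : V} (p : Quiver.Path u v), w ≠ v →
          a.right = w → arrowCoeff hZ a (MonomialAlgebra.of k Z ⟨u, v, p⟩) = 0 :=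
        fun w u v p h ha => coeff_of_ne _ _ (fun h' => h (by
          rw [← ha]; exact (congrArg QPath.tgt h').symm))
      have hl : ∀ (w : V) {u v : V} (p : Quiver.Path u v), w ≠ u →
          a.left = w → arrowCoeff hZ a (MonomialAlgebra.of k Z ⟨u, v, p⟩) = 0 :=
        fun w u v p h ha => coeff_of_ne _ _ (fun h' => h (by
          rw [← ha]; exact (congrArg QPath.src h').symm))
      cases p with
      | nil =>
        rw [← QPath.triv, arrowCoeff_vertex, zero_mul, add_zero]
        by_cases h : u = v'
        · subst h
          rw [vertex_mul_of]
          by_cases h : u = a.right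
          · subst h
            rw [vertexCoeff_vertex_self, one_mul]
          · rw [vertexCoeff_vertex_of_ne hZ h, hr _ q (Ne.symm h) rfl, zero_mul]
        · rw [vertex_mul_of_of_ne q h, map_zero]
          by_cases h' : u = a.right
          · rw [hr _ q h h'.symm, mul_zero]
          · rw [vertexCoeff_vertex_of_ne hZ h', zero_mul]
      | cons p c =>
        rw [vertexCoeff_of_pos hZ _ ⟨u, v, p.cons c⟩ (by simp), zero_mul, zero_add]
        cases q with
        | nil =>
          rw [← QPath.triv]
          by_cases h : u' = u
          · subst h
            rw [of_mul_vertex]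
            by_cases h : u' = a.left
            · subst h
              rw [vertexCoeff_vertex_self, mul_one]
            · rw [vertexCoeff_vertex_of_ne hZ h, hl _ _ (Ne.symm h) rfl, mul_zero]
          · rw [of_mul_vertex_of_ne _ h, map_zero]
            by_cases h' : u' = a.left
            · rw [hl _ _ h h'.symm, zero_mul]
            · rw [vertexCoeff_vertex_of_ne hZ h', mul_zero]
        | cons q d =>
          rw [vertexCoeff_of_pos hZ _ ⟨u', v', q.cons d⟩ (by simp), mul_zero]
          by_cases h : v' = u
          · subst h
            rw [of_mul_of]
            refine arrowCoeff_of_two_le _ _ _ ?_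
            simp only [Quiver.Path.length_comp, Quiver.Path.length_cons]
            omega
          · rw [of_mul_of_ne k Z h, map_zero]

end Coefficients

/-! ### Derivations, inner derivations and Lie algebra generalities -/

section Derivations

variable {k : Type*} [Field k] {C : Type*} [Ring C] [Algebra k C]

theorem derivation_mul (D : derivations k C) (x y : C) : D.1 (x * y) = D.1 x * y + x * D.1 y :=
  D.2 x y

theorem derivation_one (D : derivations k C) : D.1 1 = 0 := by
  have h := derivation_mul D 1 1
  rw [mul_one, mul_one, one_mul] at h
  exact left_eq_add.mp h

theorem derivation_algebraMap (D : derivations k C) (c : k) : D.1 (algebraMap k C c) = 0 := by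
  rw [Algebra.algebraMap_eq_smul_one, map_smul, derivation_one, smul_zero]

/-- The inner derivation given by an element. -/
def innerDerivation (c : C) : derivations k C :=
  ⟨LinearMap.mulLeft k c - LinearMap.mulRight k c, fun x y => by
    simp only [LinearMap.sub_apply, LinearMap.mulLeft_apply, LinearMap.mulRight_apply, sub_mul,
      mul_sub, mul_assoc]
    abel⟩

theorem innerDerivation_apply (c x : C) :
    (innerDerivation (k := k) c).1 x = c * x - x * c := rfl

theorem HH1.mk_eq_zero_iff (D : derivations k C) :
    HH1.mk k C D = 0 ↔ ∃ c : C, ∀ x : C, D.1 x = c * x - x * c :=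
  LieSubmodule.Quotient.mk_eq_zero' (N := innerDerivations k C) (m := D)

theorem HH1.mk_innerDerivation (c : C) : HH1.mk k C (innerDerivation c) = 0 :=
  (HH1.mk_eq_zero_iff _).mpr ⟨c, fun _ => rfl⟩

theorem HH1.mk_lie (D E : derivations k C) : HH1.mk k C ⁅D, E⁆ = ⁅HH1.mk k C D, HH1.mk k C E⁆ :=
  rfl

theorem HH1.mk_surjective : Function.Surjective (HH1.mk k C) :=
  LieSubmodule.Quotient.surjective_mk' (innerDerivations k C)

variable (k) in
/-- The Lie algebra of the derivations that vanish on a family of elements. -/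
def derivationsKilling {ι : Type*} (f : ι → C) : LieSubalgebra k (derivations k C) where
  carrier := {D | ∀ i, D.1 (f i) = 0}
  add_mem' {D E} hD hE i := by
    change D.1 (f i) + E.1 (f i) = 0
    rw [hD i, hE i, add_zero]
  zero_mem' _ := rfl
  smul_mem' c D hD i := by
    change c • D.1 (f i) = 0
    rw [hD i, smul_zero]
  lie_mem' {D E} hD hE i := by
    change D.1 (E.1 (f i)) - E.1 (D.1 (f i)) = 0
    rw [hD i, hE i, map_zero, map_zero, sub_zero]

instance : AddCommMonoid (derivations k C) := AddCommGroup.toAddCommMonoid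

instance : Module k (derivations k C) := LieAlgebra.toModule

instance {ι : Type*} (f : ι → C) : LieRing (derivationsKilling k f) :=
  LieSubalgebra.lieRing k _ _

instance {ι : Type*} (f : ι → C) : Bracket (derivationsKilling k f) (derivationsKilling k f) :=
  LieRing.toBracket

instance {ι : Type*} (f : ι → C) : LieAlgebra k (derivationsKilling k f) :=
  LieSubalgebra.lieAlgebra k _ _

instance {ι : Type*} (f : ι → C) : AddCommGroup (derivationsKilling k f) :=
  LieRing.toAddCommGroup

instance {ι : Type*} (f : ι → C) : AddCommMonoid (derivationsKilling k f) :=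
  AddCommGroup.toAddCommMonoid

instance {ι : Type*} (f : ι → C) : Module k (derivationsKilling k f) := LieAlgebra.toModule

/-- The class in the first Hochschild cohomology of a derivation killing a family of elements. -/
def HH1.mkKilling {ι : Type*} (f : ι → C) : derivationsKilling k f →ₗ[k] HH1 k C where
  toFun D := HH1.mk k C D.1
  map_add' D E := map_add (HH1.mk k C) D.1 E.1
  map_smul' c D := map_smul (HH1.mk k C) c D.1

/-- On a complete set of orthogonal idempotents every derivation agrees with an inner one. -/
theorem derivation_eq_inner_on_idempotents {ι : Type*} (s : Finset ι) (f : ι → C)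
    (hf : ∀ i ∈ s, f i * f i = f i) (horth : ∀ i ∈ s, ∀ j ∈ s, i ≠ j → f i * f j = 0)
    (hsum : ∑ i ∈ s, f i = 1) (D : derivations k C) :
    ∃ c : C, ∀ i ∈ s, D.1 (f i) = c * f i - f i * c := by
  classical
  -- With c = ∑ D(f_j) f_j, orthogonality gives c f_i = D(f_i) f_i. The Leibniz rule for f_i f_j,
  -- summed against ∑ f_j = 1, gives f_i c = D(f_i) f_i - D(f_i).
  refine ⟨∑ i ∈ s, D.1 (f i) * f i, fun i hi => ?_⟩
  have h1 : (∑ j ∈ s, D.1 (f j) * f j) * f i = D.1 (f i) * f i := by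
    rw [Finset.sum_mul, Finset.sum_eq_single i]
    · rw [mul_assoc, hf i hi]
    · intro j hj hji
      rw [mul_assoc, horth j hj i hi hji, mul_zero]
    · exact fun h => (h hi).elim
  have h2 : f i * ∑ j ∈ s, D.1 (f j) * f j = D.1 (f i) * f i - D.1 (f i) := by
    have h3 : ∀ j ∈ s, f i * (D.1 (f j) * f j) =
        (if j = i then D.1 (f i) * f i else 0) - D.1 (f i) * f j := by
      intro j hj
      have h4 : f i * D.1 (f j) = D.1 (f i * f j) - D.1 (f i) * f j := by
        rw [derivation_mul]; abel
      rw [← mul_assoc, h4, sub_mul, mul_assoc (D.1 (f i)), hf j hj]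
      split_ifs with h
      · rw [h, hf i hi]
      · rw [horth i hi j hj (Ne.symm h), map_zero, zero_mul]
    rw [Finset.mul_sum, Finset.sum_congr rfl h3, Finset.sum_sub_distrib, Finset.sum_ite_eq' s i, if_pos hi,
      ← Finset.mul_sum, hsum, mul_one]
  rw [h1, h2]
  abel

/-- A derivation of an algebra that maps generators of a subalgebra to the subalgebra restricts to
it. -/
theorem derivation_mem_adjoin {S : Set C} (D : derivations k C)
    (hD : ∀ x ∈ S, D.1 x ∈ Algebra.adjoin k S) {x : C} (hx : x ∈ Algebra.adjoin k S) :
    D.1 x ∈ Algebra.adjoin k S := by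
  induction hx using Algebra.adjoin_induction with
  | mem x hx => exact hD x hx
  | algebraMap c => rw [derivation_algebraMap]; exact zero_mem _
  | add x y _ _ hx hy => rw [map_add]; exact add_mem hx hy
  | mul x y hx' hy' hx hy =>
    rw [derivation_mul]
    exact add_mem (mul_mem hx hy') (mul_mem hx' hy)

/-- The restriction of a derivation to a subalgebra stable under it. -/
def restrictDerivation (B : Subalgebra k C) (D : derivations k C) (hD : ∀ x ∈ B, D.1 x ∈ B) :
    derivations k B :=
  ⟨D.1.restrict (p := Subalgebra.toSubmodule B) (q := Subalgebra.toSubmodule B) hD,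
    fun x y => Subtype.ext (derivation_mul D x y)⟩

/-- Two surjective homomorphisms of Lie algebras with the same kernel have isomorphic targets. -/
theorem exists_lieEquiv_of_ker_eq {L M N : Type*} [LieRing L] [LieAlgebra k L] [LieRing M]
    [LieAlgebra k M] [LieRing N] [LieAlgebra k N] (f : L →ₗ[k] M) (g : L →ₗ[k] N)
    (hfl : ∀ x y, f ⁅x, y⁆ = ⁅f x, f y⁆) (hgl : ∀ x y, g ⁅x, y⁆ = ⁅g x, g y⁆)
    (hf : Function.Surjective f) (hg : Function.Surjective g) (h : ∀ x, f x = 0 ↔ g x = 0) :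
    ∃ e : M ≃ₗ⁅k⁆ N, ∀ x, e (f x) = g x := by
  have hker : LinearMap.ker f = LinearMap.ker g := by
    ext x
    exact h x
  let e₀ : M ≃ₗ[k] N := (f.quotKerEquivOfSurjective hf).symm ≪≫ₗ
    Submodule.quotEquivOfEq _ _ hker ≪≫ₗ g.quotKerEquivOfSurjective hg
  have he : ∀ x, e₀ (f x) = g x := by
    intro x
    have : (f.quotKerEquivOfSurjective hf).symm (f x) = Submodule.Quotient.mk x := by
      rw [LinearEquiv.symm_apply_eq]
      rfl
    simp only [e₀, LinearEquiv.trans_apply, this]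
    rfl
  refine ⟨{ e₀ with map_lie' := ?_ }, he⟩
  intro x y
  obtain ⟨x, rfl⟩ := hf x
  obtain ⟨y, rfl⟩ := hf y
  change e₀ ⁅f x, f y⁆ = ⁅e₀ (f x), e₀ (f y)⁆
  rw [← hfl, he, he, he, hgl]

/-- A homomorphism of Lie algebras and a Lie functional that is non-trivial on its kernel give a
homomorphism onto a product with a line. -/
theorem exists_lieEquiv_prod {L M N : Type*} [LieRing L] [LieAlgebra k L] [LieRing M]
    [LieAlgebra k M] [LieRing N] [LieAlgebra k N] (f : L →ₗ[k] M) (p : L →ₗ[k] N) (μ : L →ₗ[k] k)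
    (hfl : ∀ x y, f ⁅x, y⁆ = ⁅f x, f y⁆) (hpl : ∀ x y, p ⁅x, y⁆ = ⁅p x, p y⁆)
    (hμl : ∀ x y : L, μ ⁅x, y⁆ = 0) (hf : Function.Surjective f) (hp : Function.Surjective p) {z : L}
    (hpz : p z = 0) (hμz : μ z = 1) (h : ∀ x, f x = 0 ↔ p x = 0 ∧ μ x = 0) :
    ∃ e : M ≃ₗ⁅k⁆ N × k, ∀ x, e (f x) = (p x, μ x) := by
  refine exists_lieEquiv_of_ker_eq f (p.prod μ) hfl (fun x y => Prod.ext (hpl x y) ?_) hf ?_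
    fun x => (h x).trans Prod.mk_eq_zero.symm
  · change μ ⁅x, y⁆ = ⁅μ x, μ y⁆
    rw [hμl, Ring.lie_def, mul_comm, sub_self]
  · rintro ⟨x, c⟩
    obtain ⟨y, rfl⟩ := hp x
    -- Adding multiples of z adjusts the second coordinate without moving the first.
    refine ⟨y + (c - μ y) • z, Prod.ext ?_ ?_⟩
    · change p (y + (c - μ y) • z) = p y
      rw [map_add, map_smul, hpz, smul_zero, add_zero]
    · change μ (y + (c - μ y) • z) = c
      rw [map_add, map_smul, hμz, smul_eq_mul]
      ring

end Derivations

/-! ### Traces on corners and the Lie functional -/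

section Trace

open MonomialAlgebra

variable {k : Type*} [Field k] {V : Type*} [Quiver V] [Fintype V] {Z : Set (QPath V)}

theorem coeff_corner_eq_zero {s t : V} {p : QPath V} (hp : MonomialAlgebra.of k Z p ≠ 0)
    (h : ¬ (p.src = s ∧ p.tgt = t)) (x : MonomialAlgebra k Z) :
    coeff p hp (vertex k Z t * x * vertex k Z s) = 0 := by
  refine corner_mem (LinearMap.ker (coeff p hp)) (fun q => ?_) x
  refine coeff_of_ne _ _ ?_
  rintro rfl
  exact h ⟨rfl, rfl⟩

/-- The trace of a derivation killing the vertices on the corner `e_t A e_s`. -/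
def cornerTrace (s t : V) : derivationsKilling k (vertex k Z) →ₗ[k] k where
  toFun D := LinearMap.trace k (MonomialAlgebra k Z)
    ((LinearMap.mulLeft k (vertex k Z t) * LinearMap.mulRight k (vertex k Z s)) * D.1.1)
  map_add' D E := by
    rw [← map_add, ← mul_add]
    rfl
  map_smul' c D := by
    rw [RingHom.id_apply, ← map_smul, ← mul_smul_comm]
    rfl

/-- Derivations killing the vertices commute with the projection P onto the corner, so tr(P D E) =
tr(P E D) by cyclicity of the trace. -/
theorem cornerTrace_lie (s t : V) (D E : derivationsKilling k (vertex k Z)) :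
    cornerTrace s t ⁅D, E⁆ = 0 := by
  set P : Module.End k (MonomialAlgebra k Z) :=
    LinearMap.mulLeft k (vertex k Z t) * LinearMap.mulRight k (vertex k Z s) with hP
  have hcomm : ∀ D : derivationsKilling k (vertex k Z), D.1.1 * P = P * D.1.1 := by
    intro D
    ext x
    simp only [hP, Module.End.mul_apply, LinearMap.mulLeft_apply, LinearMap.mulRight_apply,
      derivation_mul]
    rw [D.2 s, D.2 t, zero_mul, zero_add, mul_zero, add_zero]
  change LinearMap.trace k _ (P * (D.1.1 * E.1.1 - E.1.1 * D.1.1)) = 0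
  clear_value P
  rw [mul_sub, map_sub, ← mul_assoc, ← mul_assoc, LinearMap.trace_mul_comm k (P * E.1.1),
    ← mul_assoc, hcomm D, sub_self]

variable (hZ : ∀ p ∈ Z, 2 ≤ p.path.length) [FiniteDimensional k (MonomialAlgebra k Z)]

/-- In the path basis, the diagonal entry at a path p from s to t is the coefficient of p in wp -
pw, that is w_t - w_s. At all other paths it is zero. -/
theorem cornerTrace_inner (s t : V) (D : derivationsKilling k (vertex k Z))
    (w : MonomialAlgebra k Z) (hD : ∀ x, D.1.1 x = w * x - x * w) :
    cornerTrace s t D = Nat.card {p : NonzeroPath k Z // p.1.src = s ∧ p.1.tgt = t} *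
      (vertexCoeff hZ t w - vertexCoeff hZ s w) := by
  classical
  let _ : Fintype (NonzeroPath k Z) :=
    FiniteDimensional.fintypeBasisIndex (MonomialAlgebra.basis k Z)
  have h : ∀ p : NonzeroPath k Z,
      coeff p.1 p.2 (vertex k Z t * (D.1.1 (MonomialAlgebra.of k Z p.1) * vertex k Z s)) =
        if p.1.src = s ∧ p.1.tgt = t then vertexCoeff hZ t w - vertexCoeff hZ s w else 0 := by
    rintro ⟨⟨u, v, p⟩, hp⟩
    rw [← mul_assoc]
    split_ifs with h
    · obtain ⟨rfl, rfl⟩ := h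
      have h1 : vertex k Z v * (w * MonomialAlgebra.of k Z ⟨u, v, p⟩) * vertex k Z u =
          vertex k Z v * w * MonomialAlgebra.of k Z ⟨u, v, p⟩ := by
        rw [mul_assoc, mul_assoc, of_mul_vertex, ← mul_assoc]
      have h2 : vertex k Z v * (MonomialAlgebra.of k Z ⟨u, v, p⟩ * w) * vertex k Z u =
          MonomialAlgebra.of k Z ⟨u, v, p⟩ * (w * vertex k Z u) := by
        rw [← mul_assoc, vertex_mul_of, mul_assoc]
      rw [hD, mul_sub, sub_mul, h1, h2, map_sub, coeff_mul_of hZ, coeff_of_mul hZ,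
        vertexCoeff_mul, vertexCoeff_mul, vertexCoeff_vertex_self, vertexCoeff_vertex_self,
        one_mul, mul_one]
    · exact coeff_corner_eq_zero hp h _
  change LinearMap.trace k _ _ = _
  rw [LinearMap.trace_eq_matrix_trace k (MonomialAlgebra.basis k Z), Matrix.trace]
  simp only [Matrix.diag_apply, LinearMap.toMatrix_apply, MonomialAlgebra.basis_apply]
  refine (Finset.sum_congr rfl fun p _ => h p).trans ?_
  rw [Finset.sum_ite, Finset.sum_const_zero, add_zero, Finset.sum_const, nsmul_eq_mul,
    Nat.card_eq_fintype_card, Fintype.card_subtype]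

/-- For two vertices in the same component there is a Lie functional on the derivations killing
the vertices which measures the difference of the coefficients of an inner derivation. -/
theorem exists_lie_functional [CharZero k] {u v : V}
    (huv : Quiver.WeaklyConnectedComponent.mk u = Quiver.WeaklyConnectedComponent.mk v) :
    ∃ μ : derivationsKilling k (vertex k Z) →ₗ[k] k, (∀ D E : derivationsKilling k (vertex k Z), μ ⁅D, E⁆ = 0) ∧
      ∀ D w, (∀ x, D.1.1 x = w * x - x * w) → μ D = vertexCoeff hZ v w - vertexCoeff hZ u w := by
  have harrow : ∀ a : Quiver.Total V,
      ∃ μ : derivationsKilling k (vertex k Z) →ₗ[k] k, (∀ D E : derivationsKilling k (vertex k Z), μ ⁅D, E⁆ = 0) ∧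
        ∀ D w, (∀ x, D.1.1 x = w * x - x * w) →
          μ D = vertexCoeff hZ a.right w - vertexCoeff hZ a.left w := by
    intro a
    set N := Nat.card {p : NonzeroPath k Z // p.1.src = a.left ∧ p.1.tgt = a.right} with hN
    -- The arrow itself is one of the paths counted by N, and the characteristic is zero.
    have hN0 : (N : k) ≠ 0 := by
      have : Finite (NonzeroPath k Z) := Module.Finite.finite_basis (MonomialAlgebra.basis k Z)
      have : Nonempty {p : NonzeroPath k Z // p.1.src = a.left ∧ p.1.tgt = a.right} :=
        ⟨⟨⟨QPath.arrow a, of_ne_zero k hZ _ (by simp [QPath.arrow])⟩, rfl, rfl⟩⟩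
      exact Nat.cast_ne_zero.mpr Nat.card_pos.ne'
    refine ⟨(N : k)⁻¹ • cornerTrace a.left a.right, fun D E => ?_, fun D w hw => ?_⟩
    · rw [LinearMap.smul_apply, cornerTrace_lie, smul_zero]
    · rw [LinearMap.smul_apply, cornerTrace_inner hZ _ _ D w hw, smul_eq_mul, ← hN,
        inv_mul_cancel_left₀ hN0]
  -- The differences telescope along an undirected walk: an arrow traversed forwards is added, one
  -- traversed backwards is subtracted.
  obtain ⟨p⟩ := (Quiver.WeaklyConnectedComponent.eq u v).mp huv
  clear huv
  induction p with
  | nil => exact ⟨0, fun _ _ => rfl, fun D w _ => by simp⟩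
  | @cons b c p e ih =>
    obtain ⟨μ, hμ, hμ'⟩ := ih
    rcases e with e | e
    · obtain ⟨ν, hν, hν'⟩ := harrow ⟨b, c, e⟩
      refine ⟨μ + ν, fun D E => ?_, fun D w hw => ?_⟩
      · rw [LinearMap.add_apply, hμ, hν, add_zero]
      · rw [LinearMap.add_apply, hμ' D w hw, hν' D w hw]
        simp
    · obtain ⟨ν, hν, hν'⟩ := harrow ⟨c, b, e⟩
      refine ⟨μ - ν, fun D E => ?_, fun D w hw => ?_⟩
      · rw [LinearMap.sub_apply, hμ, hν, sub_zero]
      · rw [LinearMap.sub_apply, hμ' D w hw, hν' D w hw]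
        ring

end Trace

/-! ### Paths at the ends of the glued arrows -/

/-- The standing hypotheses: the relations have length at least two, and a source arrow is glued
with a sink arrow, the four end points being different. -/
structure IsGluable {V : Type*} [Quiver V] (Z : Set (QPath V)) (α β : Quiver.Total V) : Prop where
  two_le : ∀ p ∈ Z, 2 ≤ p.path.length
  distinct : EndpointsDistinct α β
  source : IsSourceArrow α
  sink : IsSinkArrow β

namespace IsGluable

section Paths

variable {V : Type*} [Quiver V] {Z : Set (QPath V)} {α β : Quiver.Total V} (h : IsGluable Z α β)
include h

theorem ne_all : α.left ≠ α.right ∧ α.left ≠ β.left ∧ α.left ≠ β.right ∧ α.right ≠ β.left ∧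
    α.right ≠ β.right ∧ β.left ≠ β.right := by
  have := h.distinct
  simp only [EndpointsDistinct, List.nodup_cons, List.mem_cons, List.not_mem_nil, not_or,
    or_false, List.nodup_nil, and_true, not_false_eq_true] at this
  tauto

theorem arrow_ne : α ≠ β := fun hαβ => h.ne_all.2.1 (by rw [hαβ])

theorem left_ne {a : Quiver.Total V} (ha : a ≠ α) (hb : a ≠ β) :
    a.left ≠ α.left ∧ a.left ≠ β.left ∧ a.left ≠ β.right :=
  ⟨(h.source.2 a ha).1, (h.sink.2 a hb).1, h.sink.1 a⟩

theorem right_ne {a : Quiver.Total V} (ha : a ≠ α) (hb : a ≠ β) :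
    a.right ≠ α.left ∧ a.right ≠ α.right ∧ a.right ≠ β.right :=
  ⟨h.source.1 a, (h.source.2 a ha).2, (h.sink.2 a hb).2⟩

theorem eq_triv_of_tgt_eq_left {q : QPath V} (hq : q.tgt = α.left) : q = QPath.triv α.left := by
  obtain ⟨u, v, p⟩ := q
  cases p with
  | nil => subst hq; rfl
  | cons p c => exact absurd hq (h.source.1 ⟨_, _, c⟩)

theorem eq_triv_of_src_eq_right {q : QPath V} (hq : q.src = β.right) :
    q = QPath.triv β.right := by
  obtain ⟨u, v, p⟩ := q
  induction p with
  | nil => subst hq; rfl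
  | cons p c ih => exact absurd (congrArg QPath.tgt (ih hq)) (h.sink.1 ⟨_, _, c⟩)

/-- Only `α` ends at e_2, and nothing can precede it. -/
theorem eq_of_tgt_eq_right {q : QPath V} (hq : q.tgt = α.right) :
    q = QPath.triv α.right ∨ q = QPath.arrow α := by
  obtain ⟨u, v, p⟩ := q
  cases p with
  | nil => subst hq; exact Or.inl rfl
  | @cons b _ p c =>
    right
    by_cases hc : (⟨b, v, c⟩ : Quiver.Total V) = α
    · subst hc
      cases p with
      | nil => rfl
      | cons p d => exact absurd rfl (h.source.1 ⟨_, _, d⟩)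
    · exact absurd hq (h.source.2 _ hc).2

theorem eq_of_src_eq_left {q : QPath V} (hq : q.src = β.left) :
    q = QPath.triv β.left ∨ q = QPath.arrow β := by
  obtain ⟨u, v, p⟩ := q
  induction p with
  | nil => subst hq; exact Or.inl rfl
  | @cons b v p c ih =>
    rcases ih hq with ih | ih
    · by_cases hc : (⟨b, v, c⟩ : Quiver.Total V) = β
      · subst hc
        obtain rfl : u = b := congrArg QPath.src ih
        simp only [QPath.triv, QPath.mk.injEq, heq_eq_eq, true_and] at ih
        subst ih
        exact Or.inr rfl
      · exact absurd (congrArg QPath.tgt ih) (h.sink.2 _ hc).1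
    · exact absurd (congrArg QPath.tgt ih) (h.sink.1 ⟨b, v, c⟩)

/-- Since `α` is the only arrow leaving e_1, a nontrivial path from there begins with it. The
induction is needed because paths are built up at their far end. -/
theorem exists_comp_of_src_eq_left {q : QPath V} (hq : q.src = α.left) :
    q = QPath.triv α.left ∨
      ∃ (v : V) (r : Quiver.Path α.right v), q = ⟨α.left, v, α.hom.toPath.comp r⟩ := by
  obtain ⟨u, v, p⟩ := q
  induction p with
  | nil => subst hq; exact Or.inl rfl
  | @cons b v p c ih =>
    right
    rcases ih hq with ih | ⟨w, r, ih⟩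
    · by_cases hc : (⟨b, v, c⟩ : Quiver.Total V) = α
      · subst hc
        obtain rfl : u = b := congrArg QPath.src ih
        simp only [QPath.triv, QPath.mk.injEq, heq_eq_eq, true_and] at ih
        subst ih
        exact ⟨_, Quiver.Path.nil, rfl⟩
      · exact absurd (congrArg QPath.tgt ih) (h.source.2 _ hc).1
    · obtain rfl : b = w := congrArg QPath.tgt ih
      change u = α.left at hq
      subst hq
      simp only [QPath.mk.injEq, heq_eq_eq, true_and] at ih
      subst ih
      exact ⟨v, r.cons c, rfl⟩

theorem eq_triv_of_cycle {v : V} (hv : v = α.left ∨ v = α.right ∨ v = β.left ∨ v = β.right)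
    {q : QPath V} (hs : q.src = v) (ht : q.tgt = v) : q = QPath.triv v := by
  rcases hv with rfl | rfl | rfl | rfl
  · exact h.eq_triv_of_tgt_eq_left ht
  · rcases h.eq_of_tgt_eq_right ht with rfl | rfl
    · rfl
    · exact absurd hs h.ne_all.1
  · rcases h.eq_of_src_eq_left hs with rfl | rfl
    · rfl
    · exact absurd ht h.ne_all.2.2.2.2.2.symm
  · exact h.eq_triv_of_src_eq_right hs

end Paths

/-! ### Corners of the monomial algebra at the glued vertices -/

section Corners

open MonomialAlgebra

variable {k : Type*} [Field k] {V : Type*} [Quiver V] [Fintype V] {Z : Set (QPath V)}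
  {α β : Quiver.Total V} (h : IsGluable Z α β) (x : MonomialAlgebra k Z)
include h

theorem left_corner {s : V} (hs : s ≠ α.left) : vertex k Z α.left * x * vertex k Z s = 0 :=
  corner_mem ⊥ (fun p => absurd (congrArg QPath.src
    (h.eq_triv_of_tgt_eq_left (q := ⟨s, α.left, p⟩) rfl)) hs) x

theorem corner_right {t : V} (ht : t ≠ β.right) : vertex k Z t * x * vertex k Z β.right = 0 :=
  corner_mem ⊥ (fun p => absurd (congrArg QPath.tgt
    (h.eq_triv_of_src_eq_right (q := ⟨β.right, t, p⟩) rfl)) ht) x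

theorem right_corner {s : V} (hs : s ≠ α.left) (hs' : s ≠ α.right) :
    vertex k Z α.right * x * vertex k Z s = 0 :=
  corner_mem ⊥ (fun p => by
    rcases h.eq_of_tgt_eq_right (q := ⟨s, α.right, p⟩) rfl with h | h
    · exact absurd (congrArg QPath.src h) hs'
    · exact absurd (congrArg QPath.src h) hs) x

theorem arrowCoeff_corner (a : Quiver.Total V) :
    arrowCoeff h.two_le a (vertex k Z a.right * x * vertex k Z a.left) =
      arrowCoeff h.two_le a x := by
  rw [arrowCoeff_mul, arrowCoeff_mul, arrowCoeff_vertex, arrowCoeff_vertex,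
    vertexCoeff_vertex_self, vertexCoeff_vertex_self]
  ring

theorem corner_eq_smul_of_forall {a : Quiver.Total V}
    (ha : ∀ p : Quiver.Path a.left a.right, (⟨a.left, a.right, p⟩ : QPath V) = QPath.arrow a) :
    vertex k Z a.right * x * vertex k Z a.left =
      arrowCoeff h.two_le a x • MonomialAlgebra.of k Z (QPath.arrow a) := by
  have hm := corner_mem (Submodule.span k {MonomialAlgebra.of k Z (QPath.arrow a)})
    (fun p => by rw [ha p]; exact Submodule.mem_span_singleton_self _) x
  obtain ⟨c, hc⟩ := Submodule.mem_span_singleton.mp hm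
  rw [← h.arrowCoeff_corner, ← hc, map_smul, arrowCoeff_arrow_self, smul_eq_mul, mul_one]

theorem corner_source_arrow : vertex k Z α.right * x * vertex k Z α.left =
    arrowCoeff h.two_le α x • MonomialAlgebra.of k Z (QPath.arrow α) :=
  h.corner_eq_smul_of_forall x fun _ => (h.eq_of_tgt_eq_right rfl).resolve_left
    fun h' => h.ne_all.1 (congrArg QPath.src h')

theorem corner_sink_arrow : vertex k Z β.right * x * vertex k Z β.left =
    arrowCoeff h.two_le β x • MonomialAlgebra.of k Z (QPath.arrow β) :=
  h.corner_eq_smul_of_forall x fun _ => (h.eq_of_src_eq_left rfl).resolve_left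
    fun h' => h.ne_all.2.2.2.2.2.symm (congrArg QPath.tgt h')

/-- No nontrivial cycle passes through a glued vertex, so these diagonal corners are lines. -/
theorem corner_cycle {v : V} (hv : v = α.left ∨ v = α.right ∨ v = β.left ∨ v = β.right) :
    vertex k Z v * x * vertex k Z v = vertexCoeff h.two_le v x • vertex k Z v := by
  have hm := corner_mem (Submodule.span k {vertex k Z v})
    (fun p => by
      rw [h.eq_triv_of_cycle hv (q := ⟨v, v, p⟩) rfl rfl]
      exact Submodule.mem_span_singleton_self _) x
  obtain ⟨c, hc⟩ := Submodule.mem_span_singleton.mp hm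
  have h1 := congrArg (vertexCoeff h.two_le v) hc
  rw [map_smul, vertexCoeff_mul, vertexCoeff_mul, vertexCoeff_vertex_self, mul_one, one_mul,
    smul_eq_mul, mul_one] at h1
  rw [← hc, h1]

/-- Away from the trivial path, everything starting at e_1 is divisible by `α`. For t = e_n this
supplies the element that corrects w when innerness is lifted to the glued algebra. -/
theorem exists_corner_eq_mul_arrow {t : V} (ht : t ≠ α.left) :
    ∃ y, vertex k Z t * x * vertex k Z α.left =
      vertex k Z t * y * vertex k Z α.right * MonomialAlgebra.of k Z (QPath.arrow α) := by
  let f : MonomialAlgebra k Z →ₗ[k] MonomialAlgebra k Z :=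
    LinearMap.mulRight k (MonomialAlgebra.of k Z (QPath.arrow α)) ∘ₗ
      LinearMap.mulRight k (vertex k Z α.right) ∘ₗ LinearMap.mulLeft k (vertex k Z t)
  have hm := corner_mem (LinearMap.range f) (fun p => by
    rcases h.exists_comp_of_src_eq_left (q := ⟨α.left, t, p⟩) rfl with h | ⟨v, r, h⟩
    · exact absurd (congrArg QPath.tgt h) ht
    · obtain rfl : t = v := congrArg QPath.tgt h
      refine ⟨MonomialAlgebra.of k Z ⟨α.right, t, r⟩, ?_⟩
      change vertex k Z t * MonomialAlgebra.of k Z ⟨α.right, t, r⟩ * vertex k Z α.right *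
        MonomialAlgebra.of k Z (QPath.arrow α) = _
      rw [vertex_mul_of, of_mul_vertex, h]
      exact of_mul_of k Z _ _) x
  obtain ⟨y, hy⟩ := hm
  exact ⟨y, hy.symm⟩

end Corners

end IsGluable

/-! ### Idempotents, arrows and paths of the glued algebra -/

section Star

open MonomialAlgebra

variable {k : Type*} [Field k] {V : Type*} [Quiver V] [Fintype V] {Z : Set (QPath V)}
  {α β : Quiver.Total V}

/-- The class of an arrow in the monomial algebra. -/
abbrev MonomialAlgebra.arrow (k : Type*) [Field k] {V : Type*} [Quiver V] [Fintype V]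
    (Z : Set (QPath V)) (a : Quiver.Total V) : MonomialAlgebra k Z :=
  MonomialAlgebra.of k Z (QPath.arrow a)

theorem MonomialAlgebra.arrow_mul_vertex (a : Quiver.Total V) :
    arrow k Z a * vertex k Z a.left = arrow k Z a := of_mul_vertex _

theorem MonomialAlgebra.vertex_mul_arrow (a : Quiver.Total V) :
    vertex k Z a.right * arrow k Z a = arrow k Z a := vertex_mul_of _

theorem MonomialAlgebra.arrow_mul_vertex_of_ne {a : Quiver.Total V} {v : V} (h : v ≠ a.left) :
    arrow k Z a * vertex k Z v = 0 := of_mul_vertex_of_ne _ h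

theorem MonomialAlgebra.vertex_mul_arrow_of_ne {a : Quiver.Total V} {v : V} (h : v ≠ a.right) :
    vertex k Z v * arrow k Z a = 0 := vertex_mul_of_of_ne _ h

theorem MonomialAlgebra.of_cons {u v w : V} (p : Quiver.Path u v) (a : v ⟶ w) :
    MonomialAlgebra.of k Z ⟨u, w, p.cons a⟩ =
      arrow k Z ⟨v, w, a⟩ * MonomialAlgebra.of k Z ⟨u, v, p⟩ :=
  (of_mul_of k Z p a.toPath).symm

/-- The map on vertices that identifies the end points of the two arrows. -/
def glueVertex (α β : Quiver.Total V) (v : V) : V :=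
  open Classical in if v = α.left then β.left else if v = β.right then α.right else v

namespace IsGluable

variable (h : IsGluable Z α β)
include h

omit [Fintype V] in
-- The map retracts the vertices onto chosen representatives, e_{n-1} and e_2 for the glued pairs;
-- its image therefore indexes the vertices of the glued quiver.
theorem glueVertex_idem (v : V) :
    glueVertex α β (glueVertex α β v) = glueVertex α β v := by
  have := h.ne_all
  unfold glueVertex
  grind

-- Writing the glued idempotents as sums over the fibres of `glueVertex` treats glued and unglued
-- vertices uniformly in the orthogonality relations.
open Classical in
theorem vertexVal_eq_sum (v : V) : vertexVal k Z α β v =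
    ∑ w, if glueVertex α β w = glueVertex α β v then vertex k Z w else 0 := by
  have hn := h.ne_all
  rw [← Finset.sum_filter, vertexVal]
  split_ifs with h1 h2
  · rw [show (Finset.univ.filter fun w => glueVertex α β w = glueVertex α β v) =
      {α.left, β.left} from ?_, Finset.sum_pair hn.2.1]
    ext w
    simp only [Finset.mem_filter, Finset.mem_univ, true_and, Finset.mem_insert,
      Finset.mem_singleton]
    unfold glueVertex
    grind
  · rw [show (Finset.univ.filter fun w => glueVertex α β w = glueVertex α β v) =
      {α.right, β.right} from ?_, Finset.sum_pair hn.2.2.2.2.1]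
    ext w
    simp only [Finset.mem_filter, Finset.mem_univ, true_and, Finset.mem_insert,
      Finset.mem_singleton]
    unfold glueVertex
    grind
  · rw [show (Finset.univ.filter fun w => glueVertex α β w = glueVertex α β v) = {v} from ?_,
      Finset.sum_singleton]
    ext w
    simp only [Finset.mem_filter, Finset.mem_univ, true_and, Finset.mem_singleton]
    unfold glueVertex
    grind

open Classical in
theorem vertex_mul_vertexVal (t v : V) : vertex k Z t * vertexVal k Z α β v =
    if glueVertex α β t = glueVertex α β v then vertex k Z t else 0 := by
  rw [h.vertexVal_eq_sum, Finset.mul_sum, Finset.sum_eq_single t]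
  · rw [mul_ite, mul_zero, vertex_mul_self]
  · intro w _ hw
    rw [mul_ite, mul_zero, vertex_mul_vertex_of_ne hw.symm, ite_self]
  · simp

open Classical in
theorem vertexVal_mul_vertex (t v : V) : vertexVal k Z α β v * vertex k Z t =
    if glueVertex α β t = glueVertex α β v then vertex k Z t else 0 := by
  rw [h.vertexVal_eq_sum, Finset.sum_mul, Finset.sum_eq_single t]
  · rw [ite_mul, zero_mul, vertex_mul_self]
  · intro w _ hw
    rw [ite_mul, zero_mul, vertex_mul_vertex_of_ne hw, ite_self]
  · simp

open Classical in
theorem vertexVal_mul_vertexVal (v w : V) : vertexVal k Z α β v * vertexVal k Z α β w =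
    if glueVertex α β v = glueVertex α β w then vertexVal k Z α β v else 0 := by
  rw [h.vertexVal_eq_sum v, Finset.sum_mul]
  split_ifs with hvw
  · refine Finset.sum_congr rfl fun t _ => ?_
    rw [ite_mul, zero_mul, h.vertex_mul_vertexVal]
    split_ifs with h1 h2
    · rfl
    · exact absurd (h1.trans hvw) h2
    · rfl
  · refine Finset.sum_eq_zero fun t _ => ?_
    rw [ite_mul, zero_mul, h.vertex_mul_vertexVal]
    split_ifs with h1 h2
    · exact absurd (h1.symm.trans h2) hvw
    · rfl
    · rfl

theorem vertexVal_glueVertex (v : V) :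
    vertexVal k Z α β (glueVertex α β v) = vertexVal k Z α β v := by
  classical
  rw [h.vertexVal_eq_sum, h.vertexVal_eq_sum, h.glueVertex_idem]

-- Summing over the image of `glueVertex` rather than over all vertices counts each fibre, hence f_1
-- and f_2, exactly once.
open Classical in
theorem sum_vertexVal :
    ∑ v ∈ Finset.univ.image (glueVertex α β), vertexVal k Z α β v = 1 := by
  rw [← sum_of_triv k Z]
  simp only [h.vertexVal_eq_sum]
  rw [Finset.sum_comm]
  refine Finset.sum_congr rfl fun w _ => ?_
  rw [Finset.sum_eq_single (glueVertex α β w)]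
  · rw [if_pos (h.glueVertex_idem w).symm]
  · intro v hv hvw
    obtain ⟨u, -, rfl⟩ := Finset.mem_image.mp hv
    rw [h.glueVertex_idem, if_neg (Ne.symm hvw)]
  · intro hw
    exact absurd (Finset.mem_image_of_mem _ (Finset.mem_univ w)) hw

omit h in
theorem arrowVal_of_ne {a : Quiver.Total V} (ha : a ≠ α) (hb : a ≠ β) :
    arrowVal k Z α β a = arrow k Z a := by
  rw [arrowVal, if_neg (by tauto)]

omit h in
theorem arrowVal_source : arrowVal k Z α β α = arrow k Z α + arrow k Z β := by
  rw [arrowVal, if_pos (Or.inl rfl)]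

omit h in
theorem arrowVal_sink : arrowVal k Z α β β = arrow k Z α + arrow k Z β := by
  rw [arrowVal, if_pos (Or.inr rfl)]

/-- The arrows `α` and `β` end at different vertices, so a vertex of A picks out one summand of γ*.
-/
theorem vertex_mul_arrowVal (a : Quiver.Total V) :
    vertex k Z a.right * arrowVal k Z α β a = arrow k Z a := by
  have hn := h.ne_all
  by_cases ha : a = α
  · subst ha
    rw [arrowVal_source, mul_add, vertex_mul_arrow, vertex_mul_arrow_of_ne (by tauto), add_zero]
  by_cases hb : a = β
  · subst hb
    rw [arrowVal_sink, mul_add, vertex_mul_arrow, vertex_mul_arrow_of_ne (by tauto), zero_add]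
  rw [arrowVal_of_ne ha hb, vertex_mul_arrow]

theorem arrowVal_mul_vertex (a : Quiver.Total V) :
    arrowVal k Z α β a * vertex k Z a.left = arrow k Z a := by
  have hn := h.ne_all
  by_cases ha : a = α
  · subst ha
    rw [arrowVal_source, add_mul, arrow_mul_vertex, arrow_mul_vertex_of_ne (by tauto), add_zero]
  by_cases hb : a = β
  · subst hb
    rw [arrowVal_sink, add_mul, arrow_mul_vertex, arrow_mul_vertex_of_ne (by tauto), zero_add]
  rw [arrowVal_of_ne ha hb, arrow_mul_vertex]

omit [Fintype V] in
theorem glueVertex_right_sink : glueVertex α β β.right = glueVertex α β α.right := by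
  have hn := h.ne_all
  unfold glueVertex
  grind

omit [Fintype V] in
theorem glueVertex_left_source : glueVertex α β α.left = glueVertex α β β.left := by
  have hn := h.ne_all
  unfold glueVertex
  grind

theorem vertexVal_mul_arrow (a : Quiver.Total V) {v : V}
    (hv : glueVertex α β a.right = glueVertex α β v) :
    vertexVal k Z α β v * arrow k Z a = arrow k Z a := by
  classical
  rw [← vertex_mul_arrow a, ← mul_assoc, h.vertexVal_mul_vertex, if_pos hv]

theorem arrow_mul_vertexVal (a : Quiver.Total V) {v : V}
    (hv : glueVertex α β a.left = glueVertex α β v) :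
    arrow k Z a * vertexVal k Z α β v = arrow k Z a := by
  classical
  rw [← arrow_mul_vertex a, mul_assoc, h.vertex_mul_vertexVal, if_pos hv]

theorem starVertex_mul_starArrow (a : Quiver.Total V) :
    starVertex k Z α β a.right * starArrow k Z α β a = starArrow k Z α β a := by
  apply Subtype.ext
  change vertexVal k Z α β a.right * arrowVal k Z α β a = arrowVal k Z α β a
  by_cases ha : a = α
  · subst ha
    rw [arrowVal_source, mul_add, h.vertexVal_mul_arrow _ rfl,
      h.vertexVal_mul_arrow _ h.glueVertex_right_sink]
  by_cases hb : a = β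
  · subst hb
    rw [arrowVal_sink, mul_add, h.vertexVal_mul_arrow _ rfl,
      h.vertexVal_mul_arrow _ h.glueVertex_right_sink.symm]
  rw [arrowVal_of_ne ha hb, h.vertexVal_mul_arrow _ rfl]

theorem starArrow_mul_starVertex (a : Quiver.Total V) :
    starArrow k Z α β a * starVertex k Z α β a.left = starArrow k Z α β a := by
  apply Subtype.ext
  change arrowVal k Z α β a * vertexVal k Z α β a.left = arrowVal k Z α β a
  by_cases ha : a = α
  · subst ha
    rw [arrowVal_source, add_mul, h.arrow_mul_vertexVal _ rfl,
      h.arrow_mul_vertexVal _ h.glueVertex_left_source.symm]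
  by_cases hb : a = β
  · subst hb
    rw [arrowVal_sink, add_mul, h.arrow_mul_vertexVal _ rfl,
      h.arrow_mul_vertexVal _ h.glueVertex_left_source]
  rw [arrowVal_of_ne ha hb, h.arrow_mul_vertexVal _ rfl]

open Classical in
theorem starVertex_mul_starVertex (v w : V) : starVertex k Z α β v * starVertex k Z α β w =
    if glueVertex α β v = glueVertex α β w then starVertex k Z α β v else 0 := by
  apply Subtype.ext
  refine (h.vertexVal_mul_vertexVal v w).trans ?_
  split_ifs <;> rfl

theorem starVertex_eq {v w : V} (hvw : glueVertex α β v = glueVertex α β w) :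
    starVertex k Z α β v = starVertex k Z α β w := by
  apply Subtype.ext
  change vertexVal k Z α β v = vertexVal k Z α β w
  rw [← h.vertexVal_glueVertex v, hvw, h.vertexVal_glueVertex]

theorem starVertex_mul_starPathAux {u v : V} (p : Quiver.Path u v) :
    starVertex k Z α β v * starPathAux k Z α β p = starPathAux k Z α β p := by
  cases p with
  | nil => rw [starPathAux, h.starVertex_mul_starVertex, if_pos rfl]
  | @cons b _ p c => rw [starPathAux, ← mul_assoc, h.starVertex_mul_starArrow ⟨b, v, c⟩]

theorem starPathAux_comp {u v w : V} (q : Quiver.Path u v) (p : Quiver.Path v w) :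
    starPathAux k Z α β (q.comp p) = starPathAux k Z α β p * starPathAux k Z α β q := by
  induction p with
  | nil => rw [Quiver.Path.comp_nil, starPathAux, h.starVertex_mul_starPathAux]
  | cons p c ih => rw [Quiver.Path.comp_cons, starPathAux, starPathAux, ih, mul_assoc]

theorem vertex_mul_starPathAux {u v : V} (p : Quiver.Path u v) :
    vertex k Z v * (starPathAux k Z α β p : MonomialAlgebra k Z) =
      MonomialAlgebra.of k Z ⟨u, v, p⟩ := by
  induction p with
  | nil =>
    change vertex k Z u * vertexVal k Z α β u = _
    exact (h.vertex_mul_vertexVal (k := k) u u).trans (if_pos rfl)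
  | @cons b v p c ih =>
    rw [starPathAux, MulMemClass.coe_mul, ← mul_assoc]
    change vertex k Z v * arrowVal k Z α β ⟨b, v, c⟩ * _ = _
    rw [h.vertex_mul_arrowVal ⟨b, v, c⟩, ← arrow_mul_vertex ⟨b, v, c⟩, mul_assoc, ih,
      of_cons p c]

theorem starPathAux_mul_vertex {u v : V} (p : Quiver.Path u v) :
    (starPathAux k Z α β p : MonomialAlgebra k Z) * vertex k Z u =
      MonomialAlgebra.of k Z ⟨u, v, p⟩ := by
  induction p with
  | nil =>
    change vertexVal k Z α β u * vertex k Z u = _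
    exact (h.vertexVal_mul_vertex (k := k) u u).trans (if_pos rfl)
  | @cons b v p c ih =>
    rw [starPathAux, MulMemClass.coe_mul, mul_assoc, ih, of_cons p c]
    conv_lhs => rw [← vertex_mul_of p, ← mul_assoc]
    exact congrArg (· * MonomialAlgebra.of k Z ⟨u, b, p⟩)
      (h.arrowVal_mul_vertex (k := k) (Z := Z) ⟨b, v, c⟩)

/-- Next to another arrow, the unwanted summand of γ* is annihilated. The last arrow c is not `α`;
if it is `β`, the extra `α` does not compose with the arrow before it. The starting vertex of c then
cuts the starred remainder down to the path itself. -/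
theorem starPath_eq_of_two_le {u v : V} (p : Quiver.Path u v) (hp : 2 ≤ p.length) :
    (starPathAux k Z α β p : MonomialAlgebra k Z) = MonomialAlgebra.of k Z ⟨u, v, p⟩ := by
  have hn := h.ne_all
  obtain _ | ⟨p, c⟩ := p
  · simp at hp
  obtain _ | ⟨p, d⟩ := p
  · simp at hp
  rename_i b b'
  set r := p.cons d with hr
  rw [starPathAux, MulMemClass.coe_mul, of_cons]
  change arrowVal k Z α β ⟨b, v, c⟩ * _ = _
  by_cases ha : (⟨b, v, c⟩ : Quiver.Total V) = α
  · exact absurd (congrArg Quiver.Total.left ha) (h.source.1 ⟨b', b, d⟩)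
  by_cases hb : (⟨b, v, c⟩ : Quiver.Total V) = β
  · rw [hb, arrowVal_sink, add_mul]
    have hbl : b = β.left := congrArg Quiver.Total.left hb
    have hd1 : (⟨b', b, d⟩ : Quiver.Total V) ≠ α := fun hd =>
      hn.2.2.2.1 (by rw [← hbl, ← hd])
    have hd2 : (⟨b', b, d⟩ : Quiver.Total V) ≠ β := fun hd =>
      hn.2.2.2.2.2 (by rw [← hbl]; exact congrArg Quiver.Total.right hd)
    have h0 : arrow k Z α * (starPathAux k Z α β r : MonomialAlgebra k Z) = 0 := by
      rw [hr, starPathAux, MulMemClass.coe_mul, ← mul_assoc]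
      change arrow k Z α * arrowVal k Z α β ⟨b', b, d⟩ * _ = _
      rw [arrowVal_of_ne hd1 hd2, ← arrow_mul_vertex α, mul_assoc (arrow k Z α),
        vertex_mul_arrow_of_ne (hn.2.1.trans_eq hbl.symm), mul_zero, zero_mul]
    rw [h0, zero_add, ← arrow_mul_vertex β, mul_assoc, mul_assoc, ← hbl, h.vertex_mul_starPathAux,
      vertex_mul_of]
  · rw [arrowVal_of_ne ha hb, ← arrow_mul_vertex ⟨b, v, c⟩, mul_assoc, mul_assoc,
      h.vertex_mul_starPathAux, vertex_mul_of]

/-- A path that vanishes in A has length at least 2, where starring changes nothing. Hence transport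
may be computed on all paths, not only on the basis. -/
theorem starPathAux_eq_zero {u v : V} (p : Quiver.Path u v)
    (hp : MonomialAlgebra.of k Z ⟨u, v, p⟩ = 0) : starPathAux k Z α β p = 0 := by
  have h2 : 2 ≤ p.length := by
    by_contra h2
    exact of_ne_zero k h.two_le ⟨u, v, p⟩ (by simpa using h2) hp
  apply Subtype.ext
  rw [h.starPath_eq_of_two_le p h2, hp]
  rfl

/-- The paths between other vertices than the glued ones lie in the glued algebra. -/
theorem of_mem_gluedAlgebra (q : QPath V) (ha : q ≠ QPath.arrow α) (hb : q ≠ QPath.arrow β)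
    (hv : ∀ v, v = α.left ∨ v = α.right ∨ v = β.left ∨ v = β.right → q ≠ QPath.triv v) :
    MonomialAlgebra.of k Z q ∈ gluedAlgebra k Z α β := by
  obtain ⟨u, v, p⟩ := q
  obtain _ | ⟨p, c⟩ := p
  · have hv' := fun h => hv u h rfl
    have : vertexVal k Z α β u = vertex k Z u := by
      rw [vertexVal, if_neg (by tauto), if_neg (by tauto)]
    have hm : vertexVal k Z α β u ∈ gluedAlgebra k Z α β := (starVertex k Z α β u).2
    rwa [this] at hm
  obtain _ | ⟨p, d⟩ := p
  · have : arrowVal k Z α β ⟨u, v, c⟩ = arrow k Z ⟨u, v, c⟩ :=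
      arrowVal_of_ne (fun h' => ha (by rw [← h']; rfl)) (fun h' => hb (by rw [← h']; rfl))
    have hm : arrowVal k Z α β ⟨u, v, c⟩ ∈ gluedAlgebra k Z α β := (starArrow k Z α β _).2
    rwa [this] at hm
  · rw [← h.starPath_eq_of_two_le _ (by simp)]
    exact Subtype.prop _

end IsGluable

end Star

/-! ### Transport of derivations from the glued algebra to the monomial algebra -/

section Pullback

open MonomialAlgebra

variable {k : Type*} [Field k] {V : Type*} [Quiver V] [Fintype V] {Z : Set (QPath V)}
  {α β : Quiver.Total V}

/-- A derivation killing the vertices vanishes as soon as it kills the arrows. -/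
theorem derivation_ext_arrow {D E : derivationsKilling k (vertex k Z)}
    (hDE : ∀ a, D.1.1 (arrow k Z a) = E.1.1 (arrow k Z a)) : D = E := by
  apply Subtype.ext
  apply Subtype.ext
  ext x
  induction x using MonomialAlgebra.induction_on with
  | zero => simp
  | add x y hx hy => rw [map_add, map_add, hx, hy]
  | smul c x hx => rw [map_smul, map_smul, hx]
  | of u v p =>
    induction p with
    | nil => exact (D.2 u).trans (E.2 u).symm
    | cons p c ih => rw [of_cons, derivation_mul, derivation_mul, ih, hDE]

/-- A derivation of the glued algebra is determined by its values on the vertices and arrows. -/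
theorem gluedDerivation_ext {D E : derivationsKilling k (starVertex k Z α β)}
    (hDE : ∀ a, D.1.1 (starArrow k Z α β a) = E.1.1 (starArrow k Z α β a)) : D = E := by
  have hsub : ∀ x (hx : x ∈ gluedAlgebra k Z α β), (D - E).1.1 ⟨x, hx⟩ = 0 := by
    intro x hx
    induction hx using Algebra.adjoin_induction with
    | mem x hx =>
      rcases hx with ⟨v, rfl⟩ | ⟨a, rfl⟩
      · exact (D - E).2 v
      · exact sub_eq_zero.mpr (hDE a)
    | algebraMap c => exact derivation_algebraMap (D - E).1 c
    | add x y hx hy hx' hy' =>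
      exact (map_add (D - E).1.1 ⟨x, hx⟩ ⟨y, hy⟩).trans (by rw [hx', hy', add_zero])
    | mul x y hx hy hx' hy' =>
      exact (derivation_mul (D - E).1 ⟨x, hx⟩ ⟨y, hy⟩).trans
        (by rw [hx', hy', zero_mul, mul_zero, add_zero])
  apply Subtype.ext
  apply Subtype.ext
  ext x
  exact congrArg Subtype.val (sub_eq_zero.mp (hsub x.1 x.2))

/-- As D kills the idempotents, the image of an arrow stays in the corner of that arrow. -/
theorem derivation_starArrow_left (h : IsGluable Z α β)
    (D : derivationsKilling k (starVertex k Z α β)) (a : Quiver.Total V) :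
    vertexVal k Z α β a.right * (D.1.1 (starArrow k Z α β a) : MonomialAlgebra k Z) =
      D.1.1 (starArrow k Z α β a) := by
  conv_rhs => rw [← h.starVertex_mul_starArrow, derivation_mul, D.2, zero_mul, zero_add]
  rfl

theorem derivation_starArrow_right (h : IsGluable Z α β)
    (D : derivationsKilling k (starVertex k Z α β)) (a : Quiver.Total V) :
    (D.1.1 (starArrow k Z α β a) : MonomialAlgebra k Z) * vertexVal k Z α β a.left =
      D.1.1 (starArrow k Z α β a) := by
  conv_rhs => rw [← h.starArrow_mul_starVertex, derivation_mul, D.2, mul_zero, add_zero]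
  rfl

/-- The linear endomorphism of the monomial algebra induced by a linear endomorphism of the glued
algebra. -/
def pullLinear : Module.End k (gluedAlgebra k Z α β) →ₗ[k] Module.End k (MonomialAlgebra k Z) where
  toFun D := (MonomialAlgebra.basis k Z).constr k fun p =>
    vertex k Z p.1.tgt * (D (starPath k Z α β p.1) : MonomialAlgebra k Z) * vertex k Z p.1.src
  map_add' D E := by
    refine (MonomialAlgebra.basis k Z).ext fun p => ?_
    simp only [Module.Basis.constr_basis, LinearMap.add_apply, AddMemClass.coe_add, mul_add,
      add_mul]
  map_smul' c D := by
    refine (MonomialAlgebra.basis k Z).ext fun p => ?_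
    simp only [Module.Basis.constr_basis, LinearMap.smul_apply, RingHom.id_apply]
    change _ * (c • (D _ : MonomialAlgebra k Z)) * _ = _
    rw [mul_smul_comm, smul_mul_assoc]

namespace IsGluable

variable (h : IsGluable Z α β)
include h

theorem pullLinear_of (D : Module.End k (gluedAlgebra k Z α β)) {u v : V} (p : Quiver.Path u v) :
    pullLinear D (MonomialAlgebra.of k Z ⟨u, v, p⟩) =
      vertex k Z v * (D (starPathAux k Z α β p) : MonomialAlgebra k Z) * vertex k Z u := by
  by_cases hp : MonomialAlgebra.of k Z ⟨u, v, p⟩ = 0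
  · rw [hp, h.starPathAux_eq_zero p hp, map_zero, map_zero, ZeroMemClass.coe_zero, mul_zero,
      zero_mul]
  · rw [← basis_apply k Z ⟨⟨u, v, p⟩, hp⟩]
    exact (MonomialAlgebra.basis k Z).constr_basis k _ _

/-- For composable paths, expand D(p* q*) by Leibniz and cut with the outer vertices: the
undifferentiated factor q* or p* becomes q or p. For other pairs both terms on the right vanish,
even if p* and q* compose in B. -/
theorem pullLinear_mul (D : derivations k (gluedAlgebra k Z α β)) (x y : MonomialAlgebra k Z) :
    pullLinear D.1 (x * y) = pullLinear D.1 x * y + x * pullLinear D.1 y := by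
  induction x using MonomialAlgebra.induction_on with
  | zero => simp
  | add x x' hx hx' =>
    simp only [add_mul, map_add, hx, hx']
    abel
  | smul c x hx => simp only [smul_mul_assoc, map_smul, hx, smul_add]
  | of v w p =>
    induction y using MonomialAlgebra.induction_on with
    | zero => simp
    | add y y' hy hy' =>
      simp only [mul_add, map_add, hy, hy']
      abel
    | smul c y hy => simp only [mul_smul_comm, map_smul, hy, smul_add]
    | of u v' q =>
      rw [h.pullLinear_of, h.pullLinear_of]
      by_cases hv : v' = v
      · subst hv
        rw [of_mul_of, h.pullLinear_of, h.starPathAux_comp, derivation_mul, AddMemClass.coe_add,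
          MulMemClass.coe_mul, MulMemClass.coe_mul, mul_add, add_mul]
        congr 1
        · rw [mul_assoc, mul_assoc, h.starPathAux_mul_vertex, mul_assoc, mul_assoc,
            vertex_mul_of]
        · rw [← mul_assoc, h.vertex_mul_starPathAux, ← mul_assoc, ← mul_assoc, of_mul_vertex]
      · rw [of_mul_of_ne k Z hv, map_zero, mul_assoc, vertex_mul_of_of_ne _ (Ne.symm hv), mul_zero,
          zero_add, ← mul_assoc, ← mul_assoc, of_mul_vertex_of_ne _ hv, zero_mul, zero_mul]

/-- The derivation of the monomial algebra induced by a derivation of the glued algebra. -/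
def pullDerivation :
    derivationsKilling k (starVertex k Z α β) →ₗ[k] derivationsKilling k (vertex k Z) where
  toFun D := ⟨⟨pullLinear D.1.1, h.pullLinear_mul D.1⟩, fun v => by
    refine (h.pullLinear_of D.1.1 (Quiver.Path.nil : Quiver.Path v v)).trans ?_
    rw [starPathAux, D.2, ZeroMemClass.coe_zero, mul_zero, zero_mul]⟩
  map_add' D E := Subtype.ext (Subtype.ext (map_add pullLinear D.1.1 E.1.1))
  map_smul' c D := Subtype.ext (Subtype.ext (map_smul pullLinear c D.1.1))

theorem starPathAux_toPath (a : Quiver.Total V) :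
    starPathAux k Z α β a.hom.toPath = starArrow k Z α β a :=
  h.starArrow_mul_starVertex a

theorem pullDerivation_arrow (D : derivationsKilling k (starVertex k Z α β))
    (a : Quiver.Total V) : (h.pullDerivation D).1.1 (arrow k Z a) =
      vertex k Z a.right * (D.1.1 (starArrow k Z α β a) : MonomialAlgebra k Z) *
        vertex k Z a.left := by
  rw [← h.starPathAux_toPath]
  exact h.pullLinear_of D.1.1 a.hom.toPath

theorem corner_eq_zero {x : MonomialAlgebra k Z} {v w : V} (hl : vertexVal k Z α β w * x = x)
    (hr : x * vertexVal k Z α β v = x) {s t : V}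
    (hst : ¬ (glueVertex α β s = glueVertex α β v ∧ glueVertex α β t = glueVertex α β w)) :
    vertex k Z t * x * vertex k Z s = 0 := by
  classical
  by_cases ht : glueVertex α β t = glueVertex α β w
  · rw [← hr, mul_assoc, mul_assoc, h.vertexVal_mul_vertex, if_neg (by tauto), mul_zero, mul_zero]
  · rw [← hl, ← mul_assoc, h.vertex_mul_vertexVal, if_neg ht, zero_mul, zero_mul]

/-- Gluing could add only corners starting at e_n in place of e_2, or ending at e_1 in place of
e_{n-1}. These are zero because e_n is a sink and e_1 is a source. -/
theorem arrow_corner_eq_zero {a : Quiver.Total V} (ha : a ≠ α) (hb : a ≠ β)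
    {x : MonomialAlgebra k Z} (hl : vertexVal k Z α β a.right * x = x)
    (hr : x * vertexVal k Z α β a.left = x) {s t : V} (hst : ¬ (s = a.left ∧ t = a.right)) :
    vertex k Z t * x * vertex k Z s = 0 := by
  have hn := h.ne_all
  obtain ⟨hl1, hl2, hl3⟩ := h.left_ne ha hb
  obtain ⟨hr1, hr2, hr3⟩ := h.right_ne ha hb
  by_cases hg : glueVertex α β s = glueVertex α β a.left ∧
    glueVertex α β t = glueVertex α β a.right
  · by_cases ht : t = α.left
    · subst ht
      refine h.left_corner x fun hs => hl2 ?_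
      have := hg.1
      unfold glueVertex at this
      grind
    · by_cases hs : s = β.right
      · subst hs
        refine h.corner_right x fun ht => hr2 ?_
        have := hg.2
        unfold glueVertex at this
        grind
      · exfalso
        apply hst
        unfold glueVertex at hg
        grind
  · exact h.corner_eq_zero hl hr hg

/-- Gluing γ* leaves four possible corners: those of `α` and `β`, the one from e_1 to e_n, and the
one from e_{n-1} to e_2, which contains no path. -/
theorem gamma_corner_eq_zero {x : MonomialAlgebra k Z} (hl : vertexVal k Z α β α.right * x = x)
    (hr : x * vertexVal k Z α β α.left = x) {s t : V} (h1 : ¬ (s = α.left ∧ t = α.right))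
    (h2 : ¬ (s = β.left ∧ t = β.right)) (h3 : ¬ (s = α.left ∧ t = β.right)) :
    vertex k Z t * x * vertex k Z s = 0 := by
  have hn := h.ne_all
  by_cases hg : glueVertex α β s = glueVertex α β α.left ∧
    glueVertex α β t = glueVertex α β α.right
  · have : s = β.left ∧ t = α.right := by
      unfold glueVertex at hg
      grind
    rw [this.1, this.2]
    exact h.right_corner x hn.2.1.symm hn.2.2.2.1.symm
  · exact h.corner_eq_zero hl hr hg

omit h in
theorem starArrow_sink : starArrow k Z α β β = starArrow k Z α β α :=
  Subtype.ext (arrowVal_sink.trans arrowVal_source.symm)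

/-- Away from the corner between the ends of the two arrows, the induced derivation agrees with the
derivation of the glued algebra. -/
theorem pullDerivation_corner (D : derivationsKilling k (starVertex k Z α β))
    (y : gluedAlgebra k Z α β) {s t : V} (hst : ¬ (s = α.left ∧ t = β.right)) :
    (h.pullDerivation D).1.1 (vertex k Z t * y * vertex k Z s) =
      vertex k Z t * (D.1.1 y : MonomialAlgebra k Z) * vertex k Z s := by
  classical
  have hn := h.ne_all
  set F := h.pullDerivation D with hF
  have hvv : ∀ s t, F.1.1 (vertex k Z t * vertex k Z s) = 0 := fun s t => by
    rw [derivation_mul, F.2, F.2, zero_mul, mul_zero, add_zero]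
  have harrow : ∀ (a : Quiver.Total V) {s t : V}, s = a.left → t = a.right →
      F.1.1 (vertex k Z t * (starArrow k Z α β a : MonomialAlgebra k Z) * vertex k Z s) =
        vertex k Z t * (D.1.1 (starArrow k Z α β a) : MonomialAlgebra k Z) * vertex k Z s := by
    rintro a s t rfl rfl
    rw [← h.pullDerivation_arrow, ← hF]
    congr 1
    change vertex k Z a.right * arrowVal k Z α β a * _ = _
    rw [h.vertex_mul_arrowVal, arrow_mul_vertex]
  obtain ⟨y, hy⟩ := y
  induction hy using Algebra.adjoin_induction generalizing s t with
  | mem x hx =>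
    rcases hx with ⟨v, rfl⟩ | ⟨a, rfl⟩
    · have h1 : D.1.1 ⟨vertexVal k Z α β v, Algebra.subset_adjoin (Or.inl ⟨v, rfl⟩)⟩ = 0 := D.2 v
      rw [h1, ZeroMemClass.coe_zero, mul_zero, zero_mul, h.vertex_mul_vertexVal]
      split_ifs
      · exact hvv s t
      · rw [zero_mul, map_zero]
    · change F.1.1 (vertex k Z t * (starArrow k Z α β a : MonomialAlgebra k Z) * vertex k Z s) =
        vertex k Z t * (D.1.1 (starArrow k Z α β a) : MonomialAlgebra k Z) * vertex k Z s
      have hz : vertex k Z t * (starArrow k Z α β a : MonomialAlgebra k Z) *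
          vertex k Z s = 0 →
          vertex k Z t * (D.1.1 (starArrow k Z α β a) : MonomialAlgebra k Z) * vertex k Z s = 0 →
          F.1.1 (vertex k Z t * (starArrow k Z α β a : MonomialAlgebra k Z) * vertex k Z s) =
            vertex k Z t * (D.1.1 (starArrow k Z α β a) : MonomialAlgebra k Z) *
              vertex k Z s := fun h1 h2 => by rw [h1, h2, map_zero]
      have hl : vertexVal k Z α β a.right * (starArrow k Z α β a : MonomialAlgebra k Z) =
          starArrow k Z α β a := congrArg Subtype.val (h.starVertex_mul_starArrow a)
      have hr : (starArrow k Z α β a : MonomialAlgebra k Z) * vertexVal k Z α β a.left =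
          starArrow k Z α β a := congrArg Subtype.val (h.starArrow_mul_starVertex a)
      by_cases hab : a = α ∨ a = β
      · have hγ : starArrow k Z α β a = starArrow k Z α β α := by
          rcases hab with rfl | rfl
          · rfl
          · exact starArrow_sink
        by_cases h1 : s = α.left ∧ t = α.right
        · rw [hγ]
          exact harrow α h1.1 h1.2
        by_cases h2 : s = β.left ∧ t = β.right
        · rw [hγ, ← starArrow_sink]
          exact harrow β h2.1 h2.2
        rw [hγ] at hz ⊢
        refine hz (h.gamma_corner_eq_zero ?_ ?_ h1 h2 hst)
          (h.gamma_corner_eq_zero ?_ ?_ h1 h2 hst)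
        · exact congrArg Subtype.val (h.starVertex_mul_starArrow α)
        · exact congrArg Subtype.val (h.starArrow_mul_starVertex α)
        · exact derivation_starArrow_left h D α
        · exact derivation_starArrow_right h D α
      · rw [not_or] at hab
        by_cases h1 : s = a.left ∧ t = a.right
        · exact harrow a h1.1 h1.2
        · exact hz (h.arrow_corner_eq_zero hab.1 hab.2 hl hr h1)
            (h.arrow_corner_eq_zero hab.1 hab.2 (derivation_starArrow_left h D a)
              (derivation_starArrow_right h D a) h1)
  | algebraMap c =>
    have h1 : D.1.1 ⟨algebraMap k _ c, Subalgebra.algebraMap_mem _ c⟩ = 0 :=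
      derivation_algebraMap D.1 c
    rw [h1, ZeroMemClass.coe_zero, mul_zero, zero_mul]
    change F.1.1 (vertex k Z t * algebraMap k _ c * vertex k Z s) = 0
    rw [Algebra.algebraMap_eq_smul_one, mul_smul_comm, mul_one, smul_mul_assoc, map_smul, hvv, smul_zero]
  | add x y hx hy hx' hy' =>
    have h1 : D.1.1 ⟨x + y, add_mem hx hy⟩ = D.1.1 ⟨x, hx⟩ + D.1.1 ⟨y, hy⟩ :=
      map_add D.1.1 ⟨x, hx⟩ ⟨y, hy⟩
    rw [h1, AddMemClass.coe_add, mul_add, add_mul, mul_add, add_mul, map_add, hx' hst, hy' hst]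
  | mul x y hx hy hx' hy' =>
    have h1 : D.1.1 ⟨x * y, mul_mem hx hy⟩ = D.1.1 ⟨x, hx⟩ * ⟨y, hy⟩ + ⟨x, hx⟩ * D.1.1 ⟨y, hy⟩ :=
      derivation_mul D.1 ⟨x, hx⟩ ⟨y, hy⟩
    -- Expand the product over the intermediate vertex u. If one factor lies in the excluded corner,
    -- the other would have to enter e_1 or leave e_n from elsewhere, so that term is zero.
    have h2 : ∀ x y : MonomialAlgebra k Z, vertex k Z t * (x * y) * vertex k Z s =
        ∑ u, vertex k Z t * x * vertex k Z u * (vertex k Z u * y * vertex k Z s) := by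
      intro x y
      rw [← mul_assoc, mul_assoc, mul_eq_sum]
      refine Finset.sum_congr rfl fun u _ => ?_
      rw [mul_assoc (vertex k Z u)]
    rw [h1, AddMemClass.coe_add, MulMemClass.coe_mul, MulMemClass.coe_mul, mul_add, add_mul,
      h2, h2, h2, map_sum, ← Finset.sum_add_distrib]
    refine Finset.sum_congr rfl fun u _ => ?_
    rw [derivation_mul]
    congr 1
    · by_cases hu : u = α.left ∧ t = β.right
      · rw [hu.1, h.left_corner y (by tauto), mul_zero, mul_zero]
      · rw [hx' hu]
    · by_cases hu : s = α.left ∧ u = β.right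
      · rw [hu.2, h.corner_right x (by tauto), zero_mul, zero_mul]
      · rw [hy' hu]

omit [Fintype V] in
theorem arrow_ends_ne (a : Quiver.Total V) : ¬ (a.left = α.left ∧ a.right = β.right) := by
  have hn := h.ne_all
  rintro ⟨h1, h2⟩
  by_cases ha : a = α
  · subst ha
    tauto
  · exact (h.source.2 a ha).1 h1

/-- It suffices to compare on arrows. There the inner application is a corner of an element of B,
and no arrow runs from e_1 to e_n, so the outer one is computed in B by `pullDerivation_corner`. -/
theorem pullDerivation_lie (D E : derivationsKilling k (starVertex k Z α β)) :
    h.pullDerivation ⁅D, E⁆ = ⁅h.pullDerivation D, h.pullDerivation E⁆ := by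
  refine derivation_ext_arrow fun a => ?_
  have hkey : ∀ D E : derivationsKilling k (starVertex k Z α β),
      (h.pullDerivation D).1.1 ((h.pullDerivation E).1.1 (arrow k Z a)) =
        vertex k Z a.right * (D.1.1 (E.1.1 (starArrow k Z α β a)) : MonomialAlgebra k Z) *
          vertex k Z a.left := fun D E => by
    rw [h.pullDerivation_arrow, h.pullDerivation_corner D _ (h.arrow_ends_ne a)]
  have hsub : ∀ x y z w : MonomialAlgebra k Z, z * (x - y) * w = z * x * w - z * y * w :=
    fun x y z w => by rw [mul_sub, sub_mul]
  refine (h.pullDerivation_arrow ⁅D, E⁆ a).trans ((hsub _ _ _ _).trans ?_)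
  exact congrArg₂ (· - ·) (hkey D E).symm (hkey E D).symm

end IsGluable

end Pullback

/-! ### Inner derivations, the class of γ*‖γ*, and surjectivity -/

section Comparison

open MonomialAlgebra

variable {k : Type*} [Field k] {V : Type*} [Quiver V] [Fintype V] {Z : Set (QPath V)}
  {α β : Quiver.Total V}

theorem derivation_vertexVal (D : derivationsKilling k (vertex k Z)) (v : V) :
    D.1.1 (vertexVal k Z α β v) = 0 := by
  unfold vertexVal
  split_ifs
  · rw [map_add, D.2, D.2, add_zero]
  · rw [map_add, D.2, D.2, add_zero]
  · exact D.2 v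

theorem MonomialAlgebra.eq_sum_corners {x : MonomialAlgebra k Z}
    (hx : ∀ v, x * vertex k Z v = vertex k Z v * x) :
    x = ∑ v, vertex k Z v * x * vertex k Z v := by
  conv_lhs => rw [← sum_vertex_mul x]
  refine Finset.sum_congr rfl fun v _ => ?_
  rw [mul_assoc, hx, ← mul_assoc, vertex_mul_self]

namespace IsGluable

variable (h : IsGluable Z α β)
include h

/-- Only the diagonal part of y survives. Commuting with the f_i does not make y commute with the
vertices of A: a path from e_1 to e_{n-1} is a loop at f_1. -/
theorem pullDerivation_inner (D : derivationsKilling k (starVertex k Z α β))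
    (y : gluedAlgebra k Z α β) (hD : ∀ x, D.1.1 x = y * x - x * y) (x : MonomialAlgebra k Z) :
    (h.pullDerivation D).1.1 x =
      (∑ v, vertex k Z v * y * vertex k Z v) * x - x * ∑ v, vertex k Z v * y * vertex k Z v := by
  induction x using MonomialAlgebra.induction_on with
  | zero => simp
  | add x x' hx hx' =>
    simp only [mul_add, add_mul, map_add, hx, hx']
    abel
  | smul c x hx => simp only [mul_smul_comm, smul_mul_assoc, map_smul, hx, smul_sub]
  | of u v p =>
    have hl : (∑ v, vertex k Z v * (y : MonomialAlgebra k Z) * vertex k Z v) *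
        MonomialAlgebra.of k Z ⟨u, v, p⟩ = vertex k Z v * y * MonomialAlgebra.of k Z ⟨u, v, p⟩ := by
      rw [Finset.sum_mul, Finset.sum_eq_single v]
      · rw [mul_assoc, vertex_mul_of]
      · intro w _ hw
        rw [mul_assoc, vertex_mul_of_of_ne p hw, mul_zero]
      · simp
    have hr : MonomialAlgebra.of k Z ⟨u, v, p⟩ *
        (∑ v, vertex k Z v * (y : MonomialAlgebra k Z) * vertex k Z v) =
          MonomialAlgebra.of k Z ⟨u, v, p⟩ * y * vertex k Z u := by
      rw [Finset.mul_sum, Finset.sum_eq_single u]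
      · rw [← mul_assoc, ← mul_assoc, of_mul_vertex]
      · intro w _ hw
        rw [← mul_assoc, ← mul_assoc, of_mul_vertex_of_ne p hw, zero_mul, zero_mul]
      · simp
    refine (h.pullLinear_of D.1.1 p).trans ?_
    rw [hD, hl, hr]
    change _ * ((y : MonomialAlgebra k Z) * (starPathAux k Z α β p : MonomialAlgebra k Z) -
      (starPathAux k Z α β p : MonomialAlgebra k Z) * (y : MonomialAlgebra k Z)) * _ = _
    rw [mul_sub, sub_mul, mul_assoc, mul_assoc, h.starPathAux_mul_vertex, ← mul_assoc,
      ← mul_assoc, h.vertex_mul_starPathAux]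

open Classical in
theorem vertexCoeff_vertexVal (t v : V) : vertexCoeff h.two_le t (vertexVal k Z α β v) =
    if glueVertex α β t = glueVertex α β v then 1 else 0 := by
  have h1 := congrArg (vertexCoeff h.two_le t) (h.vertex_mul_vertexVal (k := k) t v)
  rw [vertexCoeff_mul, vertexCoeff_vertex_self, one_mul] at h1
  rw [h1]
  split_ifs
  · rw [vertexCoeff_vertex_self]
  · rw [map_zero]

theorem vertexCoeff_arrowVal (t : V) (a : Quiver.Total V) :
    vertexCoeff h.two_le t (arrowVal k Z α β a) = 0 := by
  have h0 : ∀ a, vertexCoeff h.two_le t (arrow k Z a) = 0 := fun a =>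
    vertexCoeff_of_pos _ _ _ (by simp [QPath.arrow])
  unfold arrowVal
  split_ifs
  · rw [map_add, h0, h0, add_zero]
  · exact h0 a

theorem vertexCoeff_one (v : V) : vertexCoeff h.two_le v (1 : MonomialAlgebra k Z) = 1 := by
  rw [← sum_of_triv k Z, map_sum, Finset.sum_eq_single v]
  · exact vertexCoeff_vertex_self _ v
  · intro w _ hw
    exact vertexCoeff_vertex_of_ne _ hw
  · simp

/-- The elements of the glued algebra have equal coefficients at glued vertices and arrows. -/
theorem coeff_eq_of_mem {x : MonomialAlgebra k Z} (hx : x ∈ gluedAlgebra k Z α β) :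
    vertexCoeff h.two_le α.left x = vertexCoeff h.two_le β.left x ∧
      vertexCoeff h.two_le α.right x = vertexCoeff h.two_le β.right x ∧
      arrowCoeff h.two_le α x = arrowCoeff h.two_le β x := by
  classical
  induction hx using Algebra.adjoin_induction with
  | mem x hx =>
    rcases hx with ⟨v, rfl⟩ | ⟨a, rfl⟩
    · have h0 : ∀ a, arrowCoeff h.two_le a (vertexVal k Z α β v) = 0 := fun a => by
        unfold vertexVal
        split_ifs <;> simp only [map_add, arrowCoeff_vertex, add_zero]
      rw [h.vertexCoeff_vertexVal, h.vertexCoeff_vertexVal, h.vertexCoeff_vertexVal,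
        h.vertexCoeff_vertexVal, h0, h0, h.glueVertex_left_source, h.glueVertex_right_sink]
      exact ⟨rfl, rfl, rfl⟩
    · rw [h.vertexCoeff_arrowVal, h.vertexCoeff_arrowVal, h.vertexCoeff_arrowVal,
        h.vertexCoeff_arrowVal]
      refine ⟨rfl, rfl, ?_⟩
      unfold arrowVal
      split_ifs with hab
      · rw [map_add, map_add]
        change arrowCoeff _ _ (arrow k Z α) + arrowCoeff _ _ (arrow k Z β) =
          arrowCoeff _ _ (arrow k Z α) + arrowCoeff _ _ (arrow k Z β)
        rw [arrowCoeff_arrow_self, arrowCoeff_arrow_self, arrowCoeff_arrow_of_ne _ h.arrow_ne,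
          arrowCoeff_arrow_of_ne _ h.arrow_ne.symm, add_zero, zero_add]
      · rw [not_or] at hab
        rw [arrowCoeff_arrow_of_ne _ hab.1, arrowCoeff_arrow_of_ne _ hab.2]
  | algebraMap c =>
    have h0 : ∀ a, arrowCoeff h.two_le a (1 : MonomialAlgebra k Z) = 0 := fun a => by
      rw [← sum_of_triv k Z, map_sum]
      exact Finset.sum_eq_zero fun v _ => arrowCoeff_vertex _ a v
    simp only [Algebra.algebraMap_eq_smul_one, map_smul, h.vertexCoeff_one, h0, and_self]
  | add x y _ _ hx hy =>
    simp only [map_add, hx.1, hx.2.1, hx.2.2, hy.1, hy.2.1, hy.2.2, and_self]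
  | mul x y _ _ hx hy =>
    simp only [vertexCoeff_mul, arrowCoeff_mul, hx.1, hx.2.1, hx.2.2, hy.1, hy.2.1, hy.2.2,
      and_self]

/-- A derivation of the monomial algebra that maps the arrows of the glued algebra to the glued
algebra is induced by a derivation of the latter. -/
theorem exists_pullDerivation_eq (E : derivationsKilling k (vertex k Z))
    (hE : ∀ a, E.1.1 (arrowVal k Z α β a) ∈ gluedAlgebra k Z α β) :
    ∃ D : derivationsKilling k (starVertex k Z α β), h.pullDerivation D = E ∧
      ∀ x, (D.1.1 x : MonomialAlgebra k Z) = E.1.1 x := by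
  have hmem : ∀ x ∈ gluedAlgebra k Z α β, E.1.1 x ∈ gluedAlgebra k Z α β := fun x hx =>
    derivation_mem_adjoin E.1 (by
      rintro _ (⟨v, rfl⟩ | ⟨a, rfl⟩)
      · rw [derivation_vertexVal]
        exact zero_mem _
      · exact hE a) hx
  refine ⟨⟨restrictDerivation _ E.1 hmem, fun v => Subtype.ext (derivation_vertexVal E v)⟩,
    derivation_ext_arrow fun a => ?_, fun x => rfl⟩
  refine (h.pullDerivation_arrow _ a).trans ?_
  change vertex k Z a.right * E.1.1 (arrowVal k Z α β a) * vertex k Z a.left = _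
  conv_rhs => rw [← arrow_mul_vertex, ← h.vertex_mul_arrowVal, derivation_mul, derivation_mul,
    E.2, E.2, zero_mul, mul_zero, zero_add, add_zero]

/-- The value at `α` lies in the corner of `α`, which is a line. -/
theorem killing_arrow_source (D : derivationsKilling k (vertex k Z)) :
    D.1.1 (arrow k Z α) = arrowCoeff h.two_le α (D.1.1 (arrow k Z α)) • arrow k Z α := by
  conv_lhs => rw [← arrow_mul_vertex, ← vertex_mul_arrow, derivation_mul, derivation_mul,
    D.2, D.2, zero_mul, mul_zero, zero_add, add_zero]
  exact h.corner_source_arrow _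

theorem killing_arrow_sink (D : derivationsKilling k (vertex k Z)) :
    D.1.1 (arrow k Z β) = arrowCoeff h.two_le β (D.1.1 (arrow k Z β)) • arrow k Z β := by
  conv_lhs => rw [← arrow_mul_vertex, ← vertex_mul_arrow, derivation_mul, derivation_mul,
    D.2, D.2, zero_mul, mul_zero, zero_add, add_zero]
  exact h.corner_sink_arrow _

omit h in
theorem smul_vertex_commute (s t : k) (u w v : V) :
    (s • vertex k Z u + t • vertex k Z w) * vertex k Z v =
      vertex k Z v * (s • vertex k Z u + t • vertex k Z w) := by
  have h0 : ∀ u : V, vertex k Z u * vertex k Z v = vertex k Z v * vertex k Z u := fun u => by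
    by_cases huv : u = v
    · rw [huv]
    · rw [vertex_mul_vertex_of_ne huv, vertex_mul_vertex_of_ne (Ne.symm huv)]
  simp only [add_mul, mul_add, smul_mul_assoc, mul_smul_comm, h0]

/-- The inner derivation given by a combination of the source and the sink scales the two arrows
and kills the others. -/
theorem end_vertices_inner (s t : k) :
    (∀ a, a ≠ α → a ≠ β → (-s • vertex k Z α.left + t • vertex k Z β.right) * arrow k Z a -
        arrow k Z a * (-s • vertex k Z α.left + t • vertex k Z β.right) = 0) ∧
      (-s • vertex k Z α.left + t • vertex k Z β.right) * arrow k Z α -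
        arrow k Z α * (-s • vertex k Z α.left + t • vertex k Z β.right) = s • arrow k Z α ∧
      (-s • vertex k Z α.left + t • vertex k Z β.right) * arrow k Z β -
        arrow k Z β * (-s • vertex k Z α.left + t • vertex k Z β.right) = t • arrow k Z β := by
  have hn := h.ne_all
  simp only [add_mul, mul_add, smul_mul_assoc, mul_smul_comm]
  refine ⟨fun a ha hb => ?_, ?_, ?_⟩
  · rw [vertex_mul_arrow_of_ne (h.right_ne ha hb).1.symm,
      vertex_mul_arrow_of_ne (h.right_ne ha hb).2.2.symm,
      arrow_mul_vertex_of_ne (h.left_ne ha hb).1.symm,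
      arrow_mul_vertex_of_ne (h.left_ne ha hb).2.2.symm]
    simp
  · rw [vertex_mul_arrow_of_ne hn.1, vertex_mul_arrow_of_ne hn.2.2.2.2.1.symm, arrow_mul_vertex,
      arrow_mul_vertex_of_ne hn.2.2.1.symm]
    simp
  · rw [vertex_mul_arrow_of_ne hn.2.2.1, vertex_mul_arrow,
      arrow_mul_vertex_of_ne hn.2.1, arrow_mul_vertex_of_ne hn.2.2.2.2.2.symm]
    simp

omit h in
/-- The inner derivation of the monomial algebra given by an element commuting with the
vertices. -/
theorem exists_inner_killing {w : MonomialAlgebra k Z}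
    (hw : ∀ v, w * vertex k Z v = vertex k Z v * w) :
    ∃ D : derivationsKilling k (vertex k Z), D.1 = innerDerivation w :=
  ⟨⟨innerDerivation w, fun v => by rw [innerDerivation_apply, hw, sub_self]⟩, rfl⟩

/-- The derivation `γ* ‖ γ*` of the glued algebra exists, and it induces an inner derivation. -/
theorem exists_gamma : ∃ G : derivationsKilling k (starVertex k Z α β),
    IsGammaDerivation k Z α β G.1 ∧
      (h.pullDerivation G).1 =
        innerDerivation (-(1 : k) • vertex k Z α.left + (1 : k) • vertex k Z β.right) := by
  obtain ⟨E, hE⟩ := exists_inner_killing (smul_vertex_commute (k := k) (Z := Z) (-1) 1 α.left β.right)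
  obtain ⟨h1, h2, h3⟩ := h.end_vertices_inner (k := k) 1 1
  have hγ : E.1.1 (arrow k Z α + arrow k Z β) = arrow k Z α + arrow k Z β := by
    rw [hE, map_add, innerDerivation_apply, innerDerivation_apply, h2, h3, one_smul, one_smul]
  have h0 : ∀ a, a ≠ α → a ≠ β → E.1.1 (arrowVal k Z α β a) = 0 := fun a ha hb => by
    rw [arrowVal_of_ne ha hb, hE, innerDerivation_apply, h1 a ha hb]
  obtain ⟨G, hG, hG'⟩ := h.exists_pullDerivation_eq E (fun a => by
    by_cases ha : a = α
    · rw [ha, arrowVal_source, hγ, ← arrowVal_source]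
      exact (starArrow k Z α β α).2
    by_cases hb : a = β
    · rw [hb, arrowVal_sink, hγ, ← arrowVal_sink]
      exact (starArrow k Z α β β).2
    rw [h0 a ha hb]
    exact zero_mem _)
  refine ⟨G, ⟨G.2, Subtype.ext ?_, fun a ha hb => Subtype.ext ((hG' _).trans (h0 a ha hb))⟩,
    by rw [hG, hE]⟩
  refine (hG' _).trans ?_
  change E.1.1 (arrowVal k Z α β α) = arrowVal k Z α β α
  rw [arrowVal_source, hγ]

/-- Subtract the inner derivation that agrees with D on the orthogonal idempotents f_i. -/
theorem exists_killing_mk_eq_glued (D : derivations k (gluedAlgebra k Z α β)) :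
    ∃ D₀ : derivationsKilling k (starVertex k Z α β),
      HH1.mk k (gluedAlgebra k Z α β) D₀.1 = HH1.mk k _ D := by
  classical
  obtain ⟨c, hc⟩ := derivation_eq_inner_on_idempotents
    (Finset.univ.image (glueVertex α β)) (starVertex k Z α β)
    (fun v _ => by rw [h.starVertex_mul_starVertex, if_pos rfl])
    (fun v hv w hw hvw => by
      obtain ⟨v, -, rfl⟩ := Finset.mem_image.mp hv
      obtain ⟨w, -, rfl⟩ := Finset.mem_image.mp hw
      rw [h.starVertex_mul_starVertex, h.glueVertex_idem, h.glueVertex_idem, if_neg hvw])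
    (Subtype.ext (by
      rw [AddSubmonoidClass.coe_finsetSum]
      exact h.sum_vertexVal)) D
  refine ⟨⟨D - innerDerivation c, fun v => ?_⟩, ?_⟩
  · rw [← h.starVertex_eq (h.glueVertex_idem v)]
    exact sub_eq_zero.mpr (hc _ (Finset.mem_image_of_mem _ (Finset.mem_univ v)))
  · rw [map_sub, HH1.mk_innerDerivation, sub_zero]

/-- Every class in the first Hochschild cohomology of the monomial algebra is induced by a
derivation of the glued algebra. -/
theorem exists_pullDerivation_mk_eq (D : derivations k (MonomialAlgebra k Z)) :
    ∃ D₀ : derivationsKilling k (starVertex k Z α β),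
      HH1.mk k (MonomialAlgebra k Z) (h.pullDerivation D₀).1 = HH1.mk k _ D := by
  obtain ⟨c, hc⟩ := derivation_eq_inner_on_idempotents Finset.univ (vertex k Z)
    (fun v _ => vertex_mul_self v) (fun v _ w _ hvw => vertex_mul_vertex_of_ne hvw)
    (sum_of_triv k Z) D
  let E : derivationsKilling k (vertex k Z) :=
    ⟨D - innerDerivation c, fun v => sub_eq_zero.mpr (hc v (Finset.mem_univ v))⟩
  have hs := h.killing_arrow_source E
  have ht := h.killing_arrow_sink E
  set s := arrowCoeff h.two_le α (E.1.1 (arrow k Z α))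
  set t := arrowCoeff h.two_le β (E.1.1 (arrow k Z β))
  obtain ⟨h1, h2, h3⟩ := h.end_vertices_inner s t
  obtain ⟨F, hF⟩ := exists_inner_killing (smul_vertex_commute (k := k) (Z := Z) (-s) t α.left β.right)
  have hα : (E - F).1.1 (arrow k Z α) = 0 := by
    change E.1.1 _ - F.1.1 _ = 0
    rw [hs, hF, innerDerivation_apply, h2, sub_self]
  have hβ : (E - F).1.1 (arrow k Z β) = 0 := by
    change E.1.1 _ - F.1.1 _ = 0
    rw [ht, hF, innerDerivation_apply, h3, sub_self]
  obtain ⟨D₀, hD₀, -⟩ := h.exists_pullDerivation_eq (E - F) (fun a => by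
    by_cases ha : a = α
    · rw [ha, arrowVal_source, map_add, hα, hβ, add_zero]
      exact zero_mem _
    by_cases hb : a = β
    · rw [hb, arrowVal_sink, map_add, hα, hβ, add_zero]
      exact zero_mem _
    obtain ⟨hl1, hl2, hl3⟩ := h.left_ne ha hb
    obtain ⟨hr1, hr2, hr3⟩ := h.right_ne ha hb
    rw [arrowVal_of_ne ha hb, ← arrow_mul_vertex, ← vertex_mul_arrow, derivation_mul,
      derivation_mul, (E - F).2, (E - F).2, zero_mul, mul_zero, zero_add, add_zero]
    -- A path parallel to an unglued arrow is neither `α`, nor `β`, nor trivial at a glued vertex,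
    -- so it belongs to B.
    refine corner_mem (Subalgebra.toSubmodule (gluedAlgebra k Z α β)) (fun p => ?_) _
    refine h.of_mem_gluedAlgebra _ (fun hp => hr2 (congrArg QPath.tgt hp))
      (fun hp => hr3 (congrArg QPath.tgt hp)) fun v hv hp => ?_
    have h4 := congrArg QPath.src hp
    have h5 := congrArg QPath.tgt hp
    change a.left = v at h4
    change a.right = v at h5
    subst h4
    rcases hv with hv | hv | hv | hv
    · exact hl1 hv
    · exact hr2 (h5.trans hv)
    · exact hl2 hv
    · exact hl3 hv)
  refine ⟨D₀, ?_⟩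
  rw [hD₀]
  change HH1.mk k _ (D - innerDerivation c - F.1) = _
  rw [hF, map_sub, map_sub, HH1.mk_innerDerivation, HH1.mk_innerDerivation, sub_zero, sub_zero]

end IsGluable

end Comparison

/-! ### Lifting innerness back to the glued algebra -/

section Kernel

open MonomialAlgebra

variable {k : Type*} [Field k] {V : Type*} [Quiver V] [Fintype V] {Z : Set (QPath V)}
  {α β : Quiver.Total V}

open Classical in
theorem MonomialAlgebra.corner_corner (x : MonomialAlgebra k Z) (s t u v : V) :
    vertex k Z t * (vertex k Z v * x * vertex k Z u) * vertex k Z s =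
      if s = u ∧ t = v then vertex k Z v * x * vertex k Z u else 0 := by
  split_ifs with hst
  · rw [hst.1, hst.2, ← mul_assoc, ← mul_assoc, vertex_mul_self, mul_assoc (_ * _),
      vertex_mul_self]
  · by_cases hs : s = u
    · rw [← mul_assoc, ← mul_assoc, vertex_mul_vertex_of_ne (by tauto), zero_mul, zero_mul,
        zero_mul]
    · rw [mul_assoc, mul_assoc, vertex_mul_vertex_of_ne (Ne.symm hs), mul_zero, mul_zero]

theorem vertexVal_commute {x : MonomialAlgebra k Z}
    (hx : ∀ v, x * vertex k Z v = vertex k Z v * x) (v : V) :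
    x * vertexVal k Z α β v = vertexVal k Z α β v * x := by
  unfold vertexVal
  split_ifs
  · rw [mul_add, add_mul, hx, hx]
  · rw [mul_add, add_mul, hx, hx]
  · exact hx v

namespace IsGluable

variable (h : IsGluable Z α β)
include h

/-- An element commuting with the vertices whose coefficients at glued vertices agree lies in the
glued algebra. -/
theorem mem_gluedAlgebra_of_commute {w : MonomialAlgebra k Z}
    (hw : ∀ v, w * vertex k Z v = vertex k Z v * w)
    (hl : vertexCoeff h.two_le α.left w = vertexCoeff h.two_le β.left w)
    (hr : vertexCoeff h.two_le α.right w = vertexCoeff h.two_le β.right w) :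
    w ∈ gluedAlgebra k Z α β := by
  classical
  have hn := h.ne_all
  -- Here f is the part of w at f_1 and f_2. What is left has zero corner at each glued vertex,
  -- where all cycles are trivial, and its other diagonal corners are spanned by paths in B.
  set f : MonomialAlgebra k Z := vertexCoeff h.two_le β.left w • vertexVal k Z α β β.left +
    vertexCoeff h.two_le α.right w • vertexVal k Z α β α.right with hf
  have hfmem : f ∈ gluedAlgebra k Z α β :=
    add_mem (Subalgebra.smul_mem _ (starVertex k Z α β β.left).2 _)
      (Subalgebra.smul_mem _ (starVertex k Z α β α.right).2 _)
  have hfv : ∀ v, f * vertex k Z v = vertex k Z v * f := fun v => by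
    rw [hf, add_mul, mul_add, smul_mul_assoc, smul_mul_assoc, mul_smul_comm, mul_smul_comm,
      h.vertexVal_mul_vertex, h.vertexVal_mul_vertex, h.vertex_mul_vertexVal,
      h.vertex_mul_vertexVal]
  have hx : w - f ∈ gluedAlgebra k Z α β := by
    rw [eq_sum_corners (x := w - f) fun v => by rw [sub_mul, mul_sub, hw, hfv]]
    refine sum_mem fun v _ => ?_
    by_cases hv : v = α.left ∨ v = α.right ∨ v = β.left ∨ v = β.right
    · have h0 : vertexCoeff h.two_le v (w - f) = 0 := by
        have g1 : glueVertex α β α.left = β.left := by unfold glueVertex; grind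
        have g2 : glueVertex α β β.left = β.left := by unfold glueVertex; grind
        have g3 : glueVertex α β α.right = α.right := by unfold glueVertex; grind
        have g4 : glueVertex α β β.right = α.right := by unfold glueVertex; grind
        rw [map_sub, hf, map_add, map_smul, map_smul, h.vertexCoeff_vertexVal,
          h.vertexCoeff_vertexVal, g2, g3, smul_eq_mul, smul_eq_mul]
        rcases hv with rfl | rfl | rfl | rfl
        · rw [g1, if_pos rfl, if_neg hn.2.2.2.1.symm, hl]; ring
        · rw [g3, if_neg hn.2.2.2.1, if_pos rfl]; ring
        · rw [g2, if_pos rfl, if_neg hn.2.2.2.1.symm]; ring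
        · rw [g4, if_neg hn.2.2.2.1, if_pos rfl, hr]; ring
      rw [h.corner_cycle _ hv, h0, zero_smul]
      exact zero_mem _
    · refine corner_mem (Subalgebra.toSubmodule (gluedAlgebra k Z α β)) (fun p => ?_) _
      refine h.of_mem_gluedAlgebra _ (fun hp => hv ?_) (fun hp => hv ?_) fun u hu hp => hv ?_
      · exact Or.inl (congrArg QPath.src hp)
      · exact Or.inr (Or.inr (Or.inl (congrArg QPath.src hp)))
      · have : v = u := congrArg QPath.src hp
        rwa [this]
  have := add_mem hx hfmem
  rwa [sub_add_cancel] at this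

omit h in
theorem inner_of_forall_arrow (D : derivationsKilling k (starVertex k Z α β))
    {w : MonomialAlgebra k Z} (hwB : w ∈ gluedAlgebra k Z α β)
    (hw : ∀ v, w * vertexVal k Z α β v = vertexVal k Z α β v * w)
    (hD : ∀ a, (D.1.1 (starArrow k Z α β a) : MonomialAlgebra k Z) =
      w * arrowVal k Z α β a - arrowVal k Z α β a * w) :
    ∃ y : gluedAlgebra k Z α β, ∀ x, D.1.1 x = y * x - x * y := by
  let E : derivationsKilling k (starVertex k Z α β) :=
    ⟨innerDerivation ⟨w, hwB⟩, fun v => Subtype.ext (sub_eq_zero.mpr (hw v))⟩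
  have hDE : D = E := gluedDerivation_ext fun a => Subtype.ext (hD a)
  exact ⟨⟨w, hwB⟩, fun x => by rw [hDE]; rfl⟩

set_option maxHeartbeats 1000000 in
/-- A derivation of the glued algebra that induces an inner derivation is inner itself, provided
that the coefficients at the starting vertices agree. -/
theorem inner_of_pullDerivation_inner (D : derivationsKilling k (starVertex k Z α β))
    (w : MonomialAlgebra k Z) (hD : ∀ x, (h.pullDerivation D).1.1 x = w * x - x * w)
    (hl : vertexCoeff h.two_le α.left w = vertexCoeff h.two_le β.left w) :
    ∃ y : gluedAlgebra k Z α β, ∀ x, D.1.1 x = y * x - x * y := by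
  classical
  have hn := h.ne_all
  have hw : ∀ v, w * vertex k Z v = vertex k Z v * w := fun v => by
    rw [← sub_eq_zero, ← hD, (h.pullDerivation D).2]
  have hDa : ∀ a, vertex k Z a.right * (D.1.1 (starArrow k Z α β a) : MonomialAlgebra k Z) *
      vertex k Z a.left = w * arrow k Z a - arrow k Z a * w := fun a => by
    rw [← h.pullDerivation_arrow, hD]
  have hcoeff : ∀ a, arrowCoeff h.two_le a (D.1.1 (starArrow k Z α β a) : MonomialAlgebra k Z) =
      vertexCoeff h.two_le a.right w - vertexCoeff h.two_le a.left w := fun a => by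
    rw [← h.arrowCoeff_corner, hDa, map_sub, arrowCoeff_mul, arrowCoeff_mul,
      arrowCoeff_arrow_self, vertexCoeff_of_pos _ _ (QPath.arrow a) (by simp [QPath.arrow]),
      vertexCoeff_of_pos _ _ (QPath.arrow a) (by simp [QPath.arrow])]
    ring
  -- As an element of B, D(γ*) has equal coefficients at `α` and `β`. These are w_{e_2} - w_{e_1}
  -- and w_{e_n} - w_{e_{n-1}}, so equality at the starts forces equality at the ends.
  have hr : vertexCoeff h.two_le α.right w = vertexCoeff h.two_le β.right w := by
    have h1 := hcoeff α
    have h2 := hcoeff β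
    rw [starArrow_sink, ← (h.coeff_eq_of_mem (D.1.1 (starArrow k Z α β α)).2).2.2, h1, hl] at h2
    exact sub_left_injective h2
  have hwB := h.mem_gluedAlgebra_of_commute hw hl hr
  -- The failure of w on γ*. It vanishes in the corners of `α` and `β`, leaving only the corner from
  -- e_1 to e_n.
  set g : MonomialAlgebra k Z := (D.1.1 (starArrow k Z α β α) : MonomialAlgebra k Z) -
    (w * arrowVal k Z α β α - arrowVal k Z α β α * w) with hg
  have hsandwich : ∀ (a : Quiver.Total V) (x : MonomialAlgebra k Z),
      vertex k Z a.right * x = arrow k Z a → x * vertex k Z a.left = arrow k Z a →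
      vertex k Z a.right * (w * x - x * w) * vertex k Z a.left =
        w * arrow k Z a - arrow k Z a * w := by
    intro a x h1 h2
    rw [mul_sub, sub_mul, ← mul_assoc, ← hw, mul_assoc, mul_assoc, ← mul_assoc _ x, h1,
      arrow_mul_vertex, ← mul_assoc (vertex k Z a.right), h1, mul_assoc, hw, ← mul_assoc,
      arrow_mul_vertex]
  have hg1 : vertex k Z α.right * g * vertex k Z α.left = 0 := by
    rw [hg, mul_sub, sub_mul, hDa, hsandwich α _ (h.vertex_mul_arrowVal α)
      (h.arrowVal_mul_vertex α), sub_self]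
  have hg2 : vertex k Z β.right * g * vertex k Z β.left = 0 := by
    have hαβ : arrowVal k Z α β α = arrowVal k Z α β β := arrowVal_source.trans arrowVal_sink.symm
    rw [hg, hαβ, ← starArrow_sink, mul_sub, sub_mul, hDa, hsandwich β _ (h.vertex_mul_arrowVal β)
      (h.arrowVal_mul_vertex β), sub_self]
  have hγl : vertexVal k Z α β α.right * arrowVal k Z α β α = arrowVal k Z α β α :=
    congrArg Subtype.val (h.starVertex_mul_starArrow α)
  have hγr : arrowVal k Z α β α * vertexVal k Z α β α.left = arrowVal k Z α β α :=
    congrArg Subtype.val (h.starArrow_mul_starVertex α)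
  have hgl : vertexVal k Z α β α.right * g = g := by
    rw [hg, mul_sub, mul_sub, derivation_starArrow_left h, ← mul_assoc, ← mul_assoc, hγl,
      ← vertexVal_commute hw, mul_assoc, hγl]
  have hgr : g * vertexVal k Z α β α.left = g := by
    rw [hg, sub_mul, sub_mul, derivation_starArrow_right h, mul_assoc, mul_assoc, hγr,
      vertexVal_commute hw, ← mul_assoc, hγr]
  obtain ⟨y, hy⟩ := h.exists_corner_eq_mul_arrow g hn.2.2.1.symm
  have hgy : g = vertex k Z β.right * y * vertex k Z α.right * arrow k Z α := by
    rw [← hy]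
    refine ext_corner fun s t => ?_
    rw [corner_corner]
    split_ifs with h3
    · rw [h3.1, h3.2]
    · by_cases h1 : s = α.left ∧ t = α.right
      · rw [h1.1, h1.2, hg1]
      by_cases h2 : s = β.left ∧ t = β.right
      · rw [h2.1, h2.2, hg2]
      exact h.gamma_corner_eq_zero hgl hgr h1 h2 h3
  -- Being divisible by `α`, the error g equals zα with z from e_2 to e_n. Such a z lies in B,
  -- commutes with the f_i and composes with no arrow on either side except `α`, so w + z corrects
  -- γ* without disturbing the rest.
  set z := vertex k Z β.right * y * vertex k Z α.right with hz
  have hzB : z ∈ gluedAlgebra k Z α β :=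
    corner_mem (Subalgebra.toSubmodule (gluedAlgebra k Z α β)) (fun p =>
      h.of_mem_gluedAlgebra _ (fun hp => hn.1 (congrArg QPath.src hp).symm)
        (fun hp => hn.2.2.2.1 (congrArg QPath.src hp)) fun u _ hp =>
          hn.2.2.2.2.1 ((congrArg QPath.src hp).trans (congrArg QPath.tgt hp).symm)) y
  have hza : ∀ a, a ≠ α → z * arrow k Z a = 0 := fun a ha => by
    rw [hz, mul_assoc, vertex_mul_arrow_of_ne (h.source.2 a ha).2.symm, mul_zero]
  have haz : ∀ a, arrow k Z a * z = 0 := fun a => by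
    rw [hz, ← mul_assoc, ← mul_assoc, arrow_mul_vertex_of_ne (h.sink.1 a).symm, zero_mul, zero_mul]
  have hzv : ∀ v, z * vertexVal k Z α β v = vertexVal k Z α β v * z := fun v => by
    rw [hz, mul_assoc, h.vertex_mul_vertexVal, ← mul_assoc, ← mul_assoc, h.vertexVal_mul_vertex,
      h.glueVertex_right_sink]
    split_ifs
    · rfl
    · rw [mul_zero, zero_mul, zero_mul]
  refine inner_of_forall_arrow D (add_mem hwB hzB)
    (fun v => by rw [add_mul, mul_add, vertexVal_commute hw, hzv]) fun a => ?_
  have hγ : (D.1.1 (starArrow k Z α β α) : MonomialAlgebra k Z) =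
      (w + z) * arrowVal k Z α β α - arrowVal k Z α β α * (w + z) := by
    have h1 : z * arrowVal k Z α β α = g := by
      rw [arrowVal_source, mul_add, hza β h.arrow_ne.symm, add_zero, hgy]
    have h2 : arrowVal k Z α β α * z = 0 := by
      rw [arrowVal_source, add_mul, haz, haz, add_zero]
    rw [add_mul, mul_add, h1, h2, hg]
    abel
  by_cases ha : a = α
  · rw [ha, hγ]
  by_cases hb : a = β
  · rw [hb, starArrow_sink, hγ, arrowVal_source, arrowVal_sink]
  rw [arrowVal_of_ne ha hb, add_mul, mul_add, hza a ha, haz, add_zero, add_zero, ← hDa]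
  refine ext_corner fun s t => ?_
  rw [corner_corner]
  split_ifs with hst
  · rw [hst.1, hst.2]
  · exact h.arrow_corner_eq_zero ha hb (derivation_starArrow_left h D a)
      (derivation_starArrow_right h D a) hst

end IsGluable

end Kernel

/-! ### The space Y and the resulting product decomposition -/

section Cochains

open MonomialAlgebra

variable {k : Type*} [Field k] {V : Type*} [Quiver V] [Fintype V] {Z : Set (QPath V)}
  {α β : Quiver.Total V}

variable (k Z α β) in
/-- The cochains of the glued algebra that agree with an inner derivation of the monomial algebra
on the arrows which are not glued. -/
def innerCochains : Submodule k (Quiver.Total V → gluedAlgebra k Z α β) where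
  carrier := {x | ∃ w : MonomialAlgebra k Z, (∀ v, w * vertex k Z v = vertex k Z v * w) ∧
    ∀ a, a ≠ α → a ≠ β → vertex k Z a.right * (x a : MonomialAlgebra k Z) * vertex k Z a.left =
      w * arrow k Z a - arrow k Z a * w}
  add_mem' := by
    rintro x y ⟨w, hw, hx⟩ ⟨w', hw', hy⟩
    refine ⟨w + w', fun v => by rw [add_mul, mul_add, hw, hw'], fun a ha hb => ?_⟩
    change _ * ((x a : MonomialAlgebra k Z) + (y a : MonomialAlgebra k Z)) * _ = _
    rw [mul_add, add_mul, hx a ha hb, hy a ha hb, add_mul, mul_add]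
    abel
  zero_mem' := by
    refine ⟨0, fun v => by rw [zero_mul, mul_zero], fun a _ _ => ?_⟩
    change _ * (0 : MonomialAlgebra k Z) * _ = _
    simp only [mul_zero, zero_mul, sub_zero]
  smul_mem' := by
    rintro c x ⟨w, hw, hx⟩
    refine ⟨c • w, fun v => by rw [smul_mul_assoc, mul_smul_comm, hw], fun a ha hb => ?_⟩
    change _ * (c • (x a : MonomialAlgebra k Z)) * _ = _
    rw [mul_smul_comm, smul_mul_assoc, hx a ha hb, smul_sub, smul_mul_assoc, mul_smul_comm]

namespace IsGluable

variable (h : IsGluable Z α β)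
include h

/-- Cutting undoes the stars, and the side conditions disappear because a product excluded by them
is zero in A. -/
theorem corner_pushTerm {u : V} (p : Quiver.Path u u) (a : Quiver.Total V) :
    vertex k Z a.right * (pushTerm k Z α β ⟨u, u, p⟩ a : MonomialAlgebra k Z) * vertex k Z a.left =
      arrow k Z a * MonomialAlgebra.of k Z ⟨u, u, p⟩ -
        MonomialAlgebra.of k Z ⟨u, u, p⟩ * arrow k Z a := by
  unfold pushTerm
  have h1 : ∀ x y : gluedAlgebra k Z α β, ((x - y : gluedAlgebra k Z α β) : MonomialAlgebra k Z) =
    (x : MonomialAlgebra k Z) - y := fun _ _ => rfl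
  rw [h1, mul_sub, sub_mul]
  congr 1
  · split_ifs with hp
    · have hu : u = a.left := by
        by_contra hu
        exact hp (of_mul_of_ne k Z hu)
      subst hu
      change _ * (arrowVal k Z α β a * (starPathAux k Z α β p : MonomialAlgebra k Z)) * _ = _
      rw [← mul_assoc, h.vertex_mul_arrowVal, mul_assoc, h.starPathAux_mul_vertex]
    · rw [not_not] at hp
      rw [hp, ZeroMemClass.coe_zero, mul_zero, zero_mul]
  · split_ifs with hp
    · have hu : a.right = u := by
        by_contra hu
        exact hp (of_mul_of_ne k Z hu)
      subst hu
      change _ * ((starPathAux k Z α β p : MonomialAlgebra k Z) * arrowVal k Z α β a) * _ = _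
      rw [mul_assoc, mul_assoc, h.arrowVal_mul_vertex, ← mul_assoc, h.vertex_mul_starPathAux]
    · rw [not_not] at hp
      rw [hp, ZeroMemClass.coe_zero, mul_zero, zero_mul]

theorem pushCoboundary_mem_innerCochains {p : QPath V} (hp : p.src = p.tgt) :
    pushCoboundary k Z α β p ∈ innerCochains k Z α β := by
  obtain ⟨u, v, p⟩ := p
  obtain rfl : u = v := hp
  -- The sign: the coboundary is ap - pa, while the inner derivation of w is wa - aw.
  refine ⟨-MonomialAlgebra.of k Z ⟨u, u, p⟩, fun v => ?_, fun a ha hb => ?_⟩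
  · rw [neg_mul, mul_neg]
    by_cases hv : v = u
    · subst hv
      rw [of_mul_vertex, vertex_mul_of]
    · rw [of_mul_vertex_of_ne p hv, vertex_mul_of_of_ne p hv]
  · rw [pushCoboundary, if_neg (by tauto), h.corner_pushTerm]
    rw [neg_mul, mul_neg]
    abel

/-- Special paths can only run from `α` towards `β` and have length at least 2, so p* = p. No
unglued arrow leaves e_{n-1} or e_n or enters e_1 or e_2, so the cochain vanishes on all of them and
w = 0 serves. -/
theorem deltaZero_mem_innerCochains {p : QPath V} (hp : p ∈ specialPaths k Z α β) :
    deltaZero k Z α β (starPath k Z α β p) ∈ innerCochains k Z α β := by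
  have hn := h.ne_all
  obtain ⟨-, hlen, hends, -⟩ := hp
  refine ⟨0, fun v => by rw [zero_mul, mul_zero], fun a ha hb => ?_⟩
  have hends' : (p.src = α.left ∧ p.tgt = β.left) ∨ (p.src = α.right ∧ p.tgt = β.right) := by
    rcases hends with h1 | h1 | h1 | h1
    · exact Or.inl h1
    · rw [h.eq_triv_of_tgt_eq_left h1.2] at hlen
      simp [QPath.triv] at hlen
    · exact Or.inr h1
    · rw [h.eq_triv_of_src_eq_right h1.1] at hlen
      simp [QPath.triv] at hlen
  obtain ⟨u, v, p⟩ := p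
  have hlen2 : 2 ≤ p.length := by
    by_contra hlen2
    obtain _ | ⟨p, c⟩ := p
    · simp at hlen
    obtain _ | ⟨p, d⟩ := p
    · rcases hends' with ⟨h1, h2⟩ | ⟨h1, h2⟩
      · by_cases hc : (⟨u, v, c⟩ : Quiver.Total V) = α
        · exact hn.2.2.2.1 ((congrArg Quiver.Total.right hc).symm.trans h2)
        · exact (h.source.2 _ hc).1 h1
      · by_cases hc : (⟨u, v, c⟩ : Quiver.Total V) = β
        · exact hn.2.2.2.1 (h1.symm.trans (congrArg Quiver.Total.left hc))
        · exact (h.sink.2 _ hc).2 h2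
    · simp at hlen2
  have h1 : arrow k Z a * MonomialAlgebra.of k Z ⟨u, v, p⟩ = 0 := by
    refine of_mul_of_ne k Z fun hv => ?_
    change v = a.left at hv
    rcases hends' with h2 | h2
    · exact (h.left_ne ha hb).2.1 (hv.symm.trans h2.2)
    · exact (h.left_ne ha hb).2.2 (hv.symm.trans h2.2)
  have h2 : MonomialAlgebra.of k Z ⟨u, v, p⟩ * arrow k Z a = 0 := by
    refine of_mul_of_ne k Z fun hv => ?_
    change a.right = u at hv
    rcases hends' with h2 | h2
    · exact (h.right_ne ha hb).1 (hv.trans h2.1)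
    · exact (h.right_ne ha hb).2.1 (hv.trans h2.1)
  change _ * (arrowVal k Z α β a * (starPathAux k Z α β p : MonomialAlgebra k Z) -
    (starPathAux k Z α β p : MonomialAlgebra k Z) * arrowVal k Z α β a) * _ = _
  rw [h.starPath_eq_of_two_le p hlen2, arrowVal_of_ne ha hb, h1, h2]
  simp only [mul_zero, zero_mul, sub_zero]

theorem cochainY_le_innerCochains : cochainY k Z α β ≤ innerCochains k Z α β := by
  refine sup_le (Submodule.span_le.mpr ?_) (Submodule.span_le.mpr ?_)
  · rintro _ ⟨p, hp, rfl⟩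
    exact h.pushCoboundary_mem_innerCochains hp.1
  · rintro _ ⟨p, hp, rfl⟩
    exact h.deltaZero_mem_innerCochains hp

set_option maxHeartbeats 1000000 in
/-- The derivations given by the space `Y` induce inner derivations of the monomial algebra. -/
theorem mk_pullDerivation_eq_zero_of_mem (D : derivationsKilling k (starVertex k Z α β))
    (hD : D.1 ∈ derivationY k Z α β) :
    HH1.mk k (MonomialAlgebra k Z) (h.pullDerivation D).1 = 0 := by
  obtain ⟨w, hw, hD⟩ := h.cochainY_le_innerCochains hD.2
  obtain ⟨E, hE⟩ := exists_inner_killing hw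
  -- Membership in Y controls only the unglued arrows. The difference F kills those and scales `α`
  -- and `β`, so it is inner by a combination of e_1 and e_n.
  set F := h.pullDerivation D - E with hF
  have hs := h.killing_arrow_source F
  have ht := h.killing_arrow_sink F
  set s := arrowCoeff h.two_le α (F.1.1 (arrow k Z α))
  set t := arrowCoeff h.two_le β (F.1.1 (arrow k Z β))
  obtain ⟨h1, h2, h3⟩ := h.end_vertices_inner (k := k) s t
  obtain ⟨E', hE'⟩ := exists_inner_killing
    (smul_vertex_commute (k := k) (Z := Z) (-s) t α.left β.right)
  have hFE : F = E' := derivation_ext_arrow fun a => by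
    rw [hE', innerDerivation_apply]
    by_cases ha : a = α
    · rw [ha, h2, hs]
    by_cases hb : a = β
    · rw [hb, h3, ht]
    rw [h1 a ha hb]
    change (h.pullDerivation D).1.1 (arrow k Z a) - E.1.1 (arrow k Z a) = 0
    rw [h.pullDerivation_arrow, hE, innerDerivation_apply, sub_eq_zero]
    exact hD a ha hb
  have hsum : h.pullDerivation D = E' + E := by rw [← hFE, hF, sub_add_cancel]
  rw [hsum]
  change HH1.mk k _ (E'.1 + E.1) = 0
  rw [hE, hE', map_add, HH1.mk_innerDerivation, HH1.mk_innerDerivation, add_zero]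

/-- The only arrow at e_1 is `α`, so γ*‖γ* is the image of the coboundary of e_1‖e_1. -/
theorem gamma_mem_derivationY {G : derivations k (gluedAlgebra k Z α β)}
    (hG : IsGammaDerivation k Z α β G) : G ∈ derivationY k Z α β := by
  refine ⟨hG.1, ?_⟩
  have h0 : ∀ a, a ≠ α → pushTerm k Z α β (QPath.triv α.left) a = 0 := fun a ha => by
    rw [pushTerm, if_neg (not_not.mpr (arrow_mul_vertex_of_ne (h.source.2 a ha).1.symm)),
      if_neg (not_not.mpr (vertex_mul_arrow_of_ne (h.source.1 a).symm)), sub_zero]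
  have hα : pushTerm k Z α β (QPath.triv α.left) α = starArrow k Z α β α := by
    rw [pushTerm, if_pos, if_neg (not_not.mpr (vertex_mul_arrow_of_ne (h.source.1 α).symm)),
      sub_zero]
    · exact h.starArrow_mul_starVertex α
    · refine (arrow_mul_vertex (k := k) (Z := Z) α).trans_ne ?_
      exact of_ne_zero k h.two_le _ (by simp [QPath.arrow])
  have : (fun a => G.1 (starArrow k Z α β a)) =
      pushCoboundary k Z α β (QPath.triv α.left) := by
    funext a
    rw [pushCoboundary, hα, h0 β h.arrow_ne.symm, add_zero]
    split_ifs with hab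
    · rcases hab with rfl | rfl
      · exact hG.2.1
      · rw [starArrow_sink]
        exact hG.2.1
    · rw [not_or] at hab
      rw [hG.2.2 a hab.1 hab.2, h0 a hab.1]
  rw [this]
  refine Submodule.mem_sup_left (Submodule.subset_span ⟨_, ⟨rfl, ?_⟩, rfl⟩)
  exact of_ne_zero k h.two_le _ (by simp [QPath.triv])

/-- A derivation of the glued algebra is inner if and only if it induces an inner derivation on
which the Lie functional measuring the coefficients at the starting vertices vanishes. -/
theorem mk_eq_zero_iff_pullDerivation {μ : derivationsKilling k (vertex k Z) →ₗ[k] k}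
    (hμ : ∀ D w, (∀ x, D.1.1 x = w * x - x * w) →
      μ D = vertexCoeff h.two_le β.left w - vertexCoeff h.two_le α.left w)
    (D : derivationsKilling k (starVertex k Z α β)) :
    HH1.mk k (gluedAlgebra k Z α β) D.1 = 0 ↔
      HH1.mk k (MonomialAlgebra k Z) (h.pullDerivation D).1 = 0 ∧ μ (h.pullDerivation D) = 0 := by
  rw [HH1.mk_eq_zero_iff, HH1.mk_eq_zero_iff]
  constructor
  · rintro ⟨y, hy⟩
    have hp := h.pullDerivation_inner D y hy
    refine ⟨⟨_, hp⟩, ?_⟩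
    -- Passing to the diagonal part keeps the vertex coefficients, and those of an element of B
    -- agree at e_1 and e_{n-1}.
    have hv : ∀ u, vertexCoeff h.two_le u
        (∑ v, vertex k Z v * (y : MonomialAlgebra k Z) * vertex k Z v) =
          vertexCoeff h.two_le u (y : MonomialAlgebra k Z) := fun u => by
      rw [map_sum, Finset.sum_eq_single u]
      · rw [vertexCoeff_mul, vertexCoeff_mul, vertexCoeff_vertex_self, one_mul, mul_one]
      · intro v _ hvu
        rw [vertexCoeff_mul, vertexCoeff_vertex_of_ne _ hvu, mul_zero]
      · simp
    rw [hμ _ _ hp, hv, hv, (h.coeff_eq_of_mem y.2).1, sub_self]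
  · rintro ⟨⟨w, hw⟩, hμD⟩
    rw [hμ _ w hw, sub_eq_zero] at hμD
    exact h.inner_of_pullDerivation_inner D w hw hμD.symm

set_option maxHeartbeats 4000000 in
/-- The first Hochschild cohomology of the glued algebra is the product of that of the monomial
algebra with the line given by `γ* ‖ γ*`. -/
theorem exists_lieEquiv [CharZero k] [FiniteDimensional k (MonomialAlgebra k Z)]
    (hblock : SameBlock α β) :
    ∃ (G : derivations k (gluedAlgebra k Z α β))
      (e : HH1 k (gluedAlgebra k Z α β) ≃ₗ⁅k⁆ HH1 k (MonomialAlgebra k Z) × k),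
      IsGammaDerivation k Z α β G ∧ e (HH1.mk k _ G) = (0, 1) ∧
      ∀ D : derivationsKilling k (starVertex k Z α β),
        (e (HH1.mk k _ D.1)).1 = HH1.mk k _ (h.pullDerivation D).1 := by
  have hn := h.ne_all
  obtain ⟨μ, hμ, hμ'⟩ := exists_lie_functional (k := k) h.two_le hblock
  obtain ⟨G, hG, hGp⟩ := h.exists_gamma (k := k)
  -- The element -e_1 + e_n has coefficient 0 at e_{n-1} and -1 at e_1.
  have hμG : μ (h.pullDerivation G) = 1 := by
    rw [hμ' _ _ (fun x => by rw [hGp, innerDerivation_apply])]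
    simp only [map_add, map_smul, vertexCoeff_vertex_self]
    rw [vertexCoeff_vertex_of_ne _ hn.2.1, vertexCoeff_vertex_of_ne _ hn.2.2.2.2.2.symm,
      vertexCoeff_vertex_of_ne _ hn.2.2.1.symm]
    simp
  have hmkG : HH1.mk k (MonomialAlgebra k Z) (h.pullDerivation G).1 = 0 := by
    rw [hGp, HH1.mk_innerDerivation]
  obtain ⟨e, he⟩ := exists_lieEquiv_prod (z := G) (HH1.mkKilling (starVertex k Z α β))
    (HH1.mkKilling (vertex k Z) ∘ₗ h.pullDerivation) (μ ∘ₗ h.pullDerivation)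
    (fun D E => HH1.mk_lie D.1 E.1)
    (fun D E => (congrArg (HH1.mkKilling (vertex k Z)) (h.pullDerivation_lie D E)).trans
      (HH1.mk_lie (h.pullDerivation D).1 (h.pullDerivation E).1))
    (fun D E => (congrArg μ (h.pullDerivation_lie D E)).trans (hμ _ _))
    (fun x => by
      obtain ⟨D, rfl⟩ := HH1.mk_surjective x
      exact h.exists_killing_mk_eq_glued D)
    (fun x => by
      obtain ⟨D, rfl⟩ := HH1.mk_surjective x
      exact h.exists_pullDerivation_mk_eq D)
    hmkG hμG (h.mk_eq_zero_iff_pullDerivation hμ')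
  exact ⟨G.1, e, hG, (he G).trans (Prod.ext hmkG hμG), fun D => congrArg Prod.fst (he D)⟩

end IsGluable

end Cochains

end ArrowGluing

end

theorem mainTheorem3 {k : Type*} [Field k] [CharZero k]
    {V : Type*} [Fintype V] [Quiver V] [Finite (Quiver.Total V)]
    (Z : Set (ArrowGluing.QPath V)) (hZ : ∀ p ∈ Z, 2 ≤ p.path.length)
    (hfin : FiniteDimensional k (ArrowGluing.MonomialAlgebra k Z))
    (α β : Quiver.Total V) (hdist : ArrowGluing.EndpointsDistinct α β)
    (hα : ArrowGluing.IsSourceArrow α) (hβ : ArrowGluing.IsSinkArrow β)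
    (hblock : ArrowGluing.SameBlock α β) :
    (∃ D, ArrowGluing.IsGammaDerivation k Z α β D ∧
      ArrowGluing.gluingIdeal k Z α β = Submodule.span k {ArrowGluing.HH1.mk k _ D}) ∧
    Module.finrank k (ArrowGluing.gluingIdeal k Z α β) = 1 ∧
    (∃ I : LieIdeal k (ArrowGluing.HH1 k (ArrowGluing.gluedAlgebra k Z α β)),
      I.toSubmodule = ArrowGluing.gluingIdeal k Z α β ∧
      I ≤ LieAlgebra.center k (ArrowGluing.HH1 k (ArrowGluing.gluedAlgebra k Z α β))) ∧
    Nonempty (ArrowGluing.HH1 k (ArrowGluing.gluedAlgebra k Z α β) ≃ₗ⁅k⁆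
      ArrowGluing.HH1 k (ArrowGluing.MonomialAlgebra k Z) × k) := by
  have h : ArrowGluing.IsGluable Z α β := ⟨hZ, hdist, hα, hβ⟩
  obtain ⟨G, e, hG, heG, he⟩ := h.exists_lieEquiv (k := k) hblock
  have hspan : ArrowGluing.gluingIdeal k Z α β =
      Submodule.span k {ArrowGluing.HH1.mk k _ G} := by
    apply le_antisymm
    · rintro _ ⟨D, hD, rfl⟩
      -- Elements of Y become inner on A, so their classes lie in the second factor, which is
      -- spanned by the image (0, 1) of G.
      have h1 : (e (ArrowGluing.HH1.mk k _ D)).1 = 0 :=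
        (he ⟨D, hD.1⟩).trans (h.mk_pullDerivation_eq_zero_of_mem ⟨D, hD.1⟩ hD)
      refine Submodule.mem_span_singleton.mpr ⟨(e (ArrowGluing.HH1.mk k _ D)).2, e.injective ?_⟩
      refine (map_smul e _ _).trans ?_
      rw [heG]
      exact Prod.ext ((smul_zero _).trans h1.symm) (mul_one _)
    · rw [Submodule.span_singleton_le_iff_mem]
      exact ⟨G, h.gamma_mem_derivationY hG, rfl⟩
  have hcenter : ∀ x : ArrowGluing.HH1 k (ArrowGluing.gluedAlgebra k Z α β),
      ∀ m ∈ ArrowGluing.gluingIdeal k Z α β, ⁅x, m⁆ = 0 := by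
    intro x m hm
    rw [hspan, Submodule.mem_span_singleton] at hm
    obtain ⟨c, rfl⟩ := hm
    -- The class (0, 1) is central because the factor k is commutative.
    have h1 : ⁅x, ArrowGluing.HH1.mk k _ G⁆ = 0 := by
      refine e.injective ((LieEquiv.map_lie e x _).trans (Eq.trans ?_ (map_zero e).symm))
      rw [heG]
      refine Prod.ext (lie_zero _) ?_
      change ⁅(e x).2, (1 : k)⁆ = 0
      rw [Ring.lie_def, mul_comm, sub_self]
    rw [lie_smul, h1, smul_zero]
  refine ⟨⟨G, hG, hspan⟩, ?_, ⟨⟨ArrowGluing.gluingIdeal k Z α β, fun {x m} hm => ?_⟩, rfl, ?_⟩,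
    ⟨e⟩⟩
  · rw [hspan]
    refine finrank_span_singleton fun h0 => ?_
    rw [h0, map_zero] at heG
    exact zero_ne_one (congrArg Prod.snd heG)
  · rw [hcenter x m hm]
    exact (ArrowGluing.gluingIdeal k Z α β).zero_mem
  · intro m hm
    rw [LieModule.mem_maxTrivSubmodule]
    exact fun x => hcenter x m hm
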